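/- Let $k$ be a field. A $k$-linear category is a category whose morphism sets are $k$-vector spaces and whose composition is $k$-bilinear; write ${}_y\mathcal C_x$ for the space of morphisms from $x$ to $y$. For small $k$-linear categories $\mathcal C,\mathcal D$, the category $\mathcal C\boxtimes\mathcal D$ has objects $\mathcal C_0\times\mathcal D_0$, morphism spaces ${}_{(c',d')}(\mathcal C\boxtimes\mathcal D)_{(c,d)}={}_{c'}\mathcal C_c\otimes_k{}_{d'}\mathcal D_d$ and componentwise composition. A (left) $\mathcal C$-module is a $k$-linear functor from $\mathcal C$ to $k$-vector spaces, a $\mathcal C$-$\mathcal D$-bimodule $N=({}_cN_d)$ is a $\mathcal C\boxtimes\mathcal D^{op}$-module, and a $\mathcal C$-bimodule is a $\mathcal C$-$\mathcal C$-bimodule. The Hochschild-Mitchell cohomology $H^\bullet(\mathcal C,N)$ of $\mathcal C$ with coefficients in a $\mathcal C$-bimodule $N$ is the cohomology of the complex $$C^n(\mathcal C,N)=\prod_{x_0,\dots,x_n\in\mathcal C_0}\mathrm{Hom}_k\bigl({}_{x_0}\mathcal C_{x_1}\otimes\cdots\otimes{}_{x_{n-1}}\mathcal C_{x_n},\,{}_{x_0}N_{x_n}\bigr),\qquad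 C^0(\mathcal C,N)=\prod_{x\in\mathcal C_0}{}_xN_x,$$ $$(d\varphi)(g_1,\dots,g_{n+1})=g_1\varphi(g_2,\dots,g_{n+1})+\sum_{i=1}^n(-1)^i\varphi(g_1,\dots,g_ig_{i+1},\dots,g_{n+1})+(-1)^{n+1}\varphi(g_1,\dots,g_n)g_{n+1}.$$ **Theorem.** Let $\mathcal C_1,\mathcal C_2$ be small $k$-linear categories and let $M$ be a $\mathcal C_1$-$\mathcal C_2$-bimodule. Let $\mathcal C=\mathcal C_1\sqcup_M\mathcal C_2$ be the $k$-linear category with set of objects $(\mathcal C_1)_0\sqcup(\mathcal C_2)_0$ and with ${}_x\mathcal C_y={}_x(\mathcal C_i)_y$ for $x,y\in(\mathcal C_i)_0$, ${}_x\mathcal C_y={}_xM_y$ for $x\in(\mathcal C_1)_0$, $y\in(\mathcal C_2)_0$, and ${}_x\mathcal C_y=0$ for $x\in(\mathcal C_2)_0$, $y\in(\mathcal C_1)_0$, the composition being given by those of $\mathcal C_1$, $\mathcal C_2$ and by the actions on $M$. Let $N$ be a $\mathcal C$-bimodule, let $r_{i,j}(N)$ be its restriction to $\mathcal C_i\boxtimes\mathcal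 C_j^{op}$, and put $r_i(N)=r_{i,i}(N)$. Then there is a long exact sequence of $k$-vector spaces $$0\to H^0(\mathcal C,N)\to H^0(\mathcal C_1,r_1(N))\oplus H^0(\mathcal C_2,r_2(N))\to\mathrm{Hom}_{\mathcal C_1\boxtimes\mathcal C_2^{op}}(M,r_{1,2}(N))\to H^1(\mathcal C,N)\to\cdots$$ $$\cdots\to H^n(\mathcal C,N)\to H^n(\mathcal C_1,r_1(N))\oplus H^n(\mathcal C_2,r_2(N))\to\mathrm{Ext}^n_{\mathcal C_1\boxtimes\mathcal C_2^{op}}(M,r_{1,2}(N))\to H^{n+1}(\mathcal C,N)\to\cdots$$ in which the maps $H^n(\mathcal C,N)\to H^n(\mathcal C_1,r_1(N))\oplus H^n(\mathcal C_2,r_2(N))$ are induced by the restriction of cochains. -/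

import Mathlib

open CategoryTheory Opposite
open scoped TensorProduct

universe u

noncomputable section

namespace HM

/-! ## Linear categories: opposite, external tensor product -/

/-- The opposite of a `k`-linear category is `k`-linear. -/
instance linearOpposite (k : Type u) [Field k] (C : Type u) [SmallCategory C] [Preadditive C]
    [Linear k C] : Linear k Cᵒᵖ where
  homModule _ _ :=
    { smul := fun r f => (r • f.unop).op
      one_smul := fun f => Quiver.Hom.unop_inj (one_smul k f.unop)
      mul_smul := fun r s f => Quiver.Hom.unop_inj (mul_smul r s f.unop)
      smul_zero := fun r => Quiver.Hom.unop_inj (smul_zero r)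
      smul_add := fun r f g => Quiver.Hom.unop_inj (smul_add r f.unop g.unop)
      add_smul := fun r s f => Quiver.Hom.unop_inj (add_smul r s f.unop)
      zero_smul := fun f => Quiver.Hom.unop_inj (zero_smul k f.unop) }
  smul_comp _ _ _ r f g := Quiver.Hom.unop_inj (Linear.comp_smul _ _ _ g.unop r f.unop)
  comp_smul _ _ _ f r g := Quiver.Hom.unop_inj (Linear.smul_comp _ _ _ r g.unop f.unop)

/-- Objects of the external tensor product category `C ⊠ D`: pairs of objects. -/
structure TensorCat (k : Type u) (C D : Type u) : Type u where
  fst : C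
  snd : D

section TensorCat

variable (k : Type u) [Field k] (C D : Type u) [SmallCategory C] [Preadditive C] [Linear k C]
  [SmallCategory D] [Preadditive D] [Linear k D]

variable {C D} in
/-- The composition of `C ⊠ D`: `(f ⊗ g) ≫ (f' ⊗ g') = (f ≫ f') ⊗ (g ≫ g')`. -/
def tensorComp (X Y Z : TensorCat k C D) :
    (X.fst ⟶ Y.fst) ⊗[k] (X.snd ⟶ Y.snd) →ₗ[k] (Y.fst ⟶ Z.fst) ⊗[k] (Y.snd ⟶ Z.snd) →ₗ[k]
      (X.fst ⟶ Z.fst) ⊗[k] (X.snd ⟶ Z.snd) :=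
  TensorProduct.map₂ (Linear.comp (S := k) X.fst Y.fst Z.fst)
    (Linear.comp (S := k) X.snd Y.snd Z.snd)

@[simp]
lemma tensorComp_tmul (X Y Z : TensorCat k C D) (f : X.fst ⟶ Y.fst) (g : X.snd ⟶ Y.snd)
    (f' : Y.fst ⟶ Z.fst) (g' : Y.snd ⟶ Z.snd) :
    tensorComp k X Y Z (f ⊗ₜ g) (f' ⊗ₜ g') = (f ≫ f') ⊗ₜ (g ≫ g') := rfl

/-- Morphisms of `C ⊠ D` are the tensor products over `k` of the morphism spaces. -/
instance : SmallCategory (TensorCat k C D) where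
  Hom X Y := (X.fst ⟶ Y.fst) ⊗[k] (X.snd ⟶ Y.snd)
  id X := 𝟙 X.fst ⊗ₜ[k] 𝟙 X.snd
  comp {X Y Z} f g := tensorComp k X Y Z f g
  id_comp {X Y} f := by
    induction f with
    | zero => simp
    | tmul a b => simp
    | add a b ha hb => rw [map_add, ha, hb]
  comp_id {X Y} f := by
    induction f with
    | zero => simp
    | tmul a b => simp
    | add a b ha hb => rw [map_add, LinearMap.add_apply, ha, hb]
  assoc {W X Y Z} f g h := by
    induction f with
    | zero => simp
    | add a b ha hb => simp only [map_add, LinearMap.add_apply, ha, hb]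
    | tmul a b =>
      induction g with
      | zero => simp
      | add a b ha hb => simp only [map_add, LinearMap.add_apply, ha, hb]
      | tmul c d =>
        induction h with
        | zero => simp
        | add a b ha hb => simp only [map_add, ha, hb]
        | tmul e f => simp

instance : Preadditive (TensorCat k C D) where
  homGroup X Y := inferInstanceAs (AddCommGroup ((X.fst ⟶ Y.fst) ⊗[k] (X.snd ⟶ Y.snd)))
  add_comp X Y Z f f' g := by
    change tensorComp k X Y Z (HAdd.hAdd (α := (X.fst ⟶ Y.fst) ⊗[k] (X.snd ⟶ Y.snd)) f f') g = _
    rw [map_add]; rfl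
  comp_add X Y Z f g g' := by
    change tensorComp k X Y Z f (HAdd.hAdd (α := (Y.fst ⟶ Z.fst) ⊗[k] (Y.snd ⟶ Z.snd)) g g') = _
    rw [map_add]; rfl

instance : Linear k (TensorCat k C D) where
  homModule X Y := inferInstanceAs (Module k ((X.fst ⟶ Y.fst) ⊗[k] (X.snd ⟶ Y.snd)))
  smul_comp X Y Z r f g := by
    change tensorComp k X Y Z (HSMul.hSMul (β := (X.fst ⟶ Y.fst) ⊗[k] (X.snd ⟶ Y.snd)) r f) g = _
    rw [map_smul]; rfl
  comp_smul X Y Z f r g := by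
    change tensorComp k X Y Z f (HSMul.hSMul (β := (Y.fst ⟶ Z.fst) ⊗[k] (Y.snd ⟶ Z.snd)) r g) = _
    rw [map_smul]; rfl

variable {C D}

/-- The morphism `f ⊗ g` of `C ⊠ D`, bilinear in `f` and `g`. -/
def tmulHom (a b : C) (c d : D) :
    (a ⟶ b) →ₗ[k] (c ⟶ d) →ₗ[k] ((⟨a, c⟩ : TensorCat k C D) ⟶ ⟨b, d⟩) :=
  TensorProduct.mk k (a ⟶ b) (c ⟶ d)

lemma tmulHom_id (a : C) (c : D) : tmulHom k a a c c (𝟙 a) (𝟙 c) = 𝟙 _ := rfl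

lemma tmulHom_comp {a₁ a₂ a₃ : C} {c₁ c₂ c₃ : D} (f : a₁ ⟶ a₂) (f' : a₂ ⟶ a₃)
    (g : c₁ ⟶ c₂) (g' : c₂ ⟶ c₃) :
    tmulHom k _ _ _ _ f g ≫ tmulHom k _ _ _ _ f' g' =
      tmulHom k _ _ _ _ (f ≫ f') (g ≫ g') := rfl

end TensorCat

section TensorCatMap

variable (k : Type u) [Field k] {C C' D D' : Type u}
  [SmallCategory C] [Preadditive C] [Linear k C] [SmallCategory C'] [Preadditive C'] [Linear k C']
  [SmallCategory D] [Preadditive D] [Linear k D] [SmallCategory D'] [Preadditive D'] [Linear k D']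
  (F : C ⥤ C') [F.Additive] [F.Linear k] (G : D ⥤ D') [G.Additive] [G.Linear k]

/-- The functor `F ⊠ G : C ⊠ D ⥤ C' ⊠ D'`. -/
def TensorCat.map : TensorCat k C D ⥤ TensorCat k C' D' where
  obj X := ⟨F.obj X.fst, G.obj X.snd⟩
  map f := TensorProduct.map (F.mapLinearMap k) (G.mapLinearMap k) f
  map_id X := by
    change TensorProduct.map _ _ (𝟙 X.fst ⊗ₜ[k] 𝟙 X.snd) = 𝟙 _ ⊗ₜ[k] 𝟙 _
    simp
  map_comp {X Y Z} := by
    intro (f : (X.fst ⟶ Y.fst) ⊗[k] (X.snd ⟶ Y.snd)) (g : (Y.fst ⟶ Z.fst) ⊗[k] (Y.snd ⟶ Z.snd))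
    change TensorProduct.map _ _ (tensorComp k X Y Z f g) =
      tensorComp k ⟨F.obj X.fst, G.obj X.snd⟩ ⟨F.obj Y.fst, G.obj Y.snd⟩
        ⟨F.obj Z.fst, G.obj Z.snd⟩ (TensorProduct.map _ _ f) (TensorProduct.map _ _ g)
    induction f with
    | zero => simp
    | add a b ha hb => simp only [map_add, LinearMap.add_apply, ha, hb]
    | tmul a b =>
      induction g with
      | zero => simp
      | add a b ha hb => simp only [map_add, ha, hb]
      | tmul c d => simp; rfl

instance : (TensorCat.map k F G).Additive where
  map_add {_ _ f g} := map_add (TensorProduct.map (F.mapLinearMap k) (G.mapLinearMap k)) f g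

instance : (TensorCat.map k F G).Linear k where
  map_smul f r := map_smul (TensorProduct.map (F.mapLinearMap k) (G.mapLinearMap k)) r f

instance : F.op.Linear k where
  map_smul f r := Quiver.Hom.unop_inj (F.map_smul r f.unop)

end TensorCatMap

/-! ## Modules and bimodules -/

/-- The property of being a `k`-linear functor. -/
def isLinearFunctor (k : Type u) [Field k] (C : Type u) [SmallCategory C] [Preadditive C]
    [Linear k C] : ObjectProperty (C ⥤ ModuleCat.{u} k) :=
  fun F => F.Additive ∧ F.Linear k

/-- The category of left `C`-modules: covariant `k`-linear functors from `C` to `k`-vector spaces,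
and natural transformations. -/
abbrev LMod (k : Type u) [Field k] (C : Type u) [SmallCategory C] [Preadditive C]
    [Linear k C] := (isLinearFunctor k C).FullSubcategory

/-- `C`-`D`-bimodules: left modules over `C ⊠ Dᵒᵖ`. -/
abbrev Bimod (k : Type u) [Field k] (C D : Type u) [SmallCategory C] [Preadditive C]
    [Linear k C] [SmallCategory D] [Preadditive D] [Linear k D] :=
  LMod k (TensorCat k C Dᵒᵖ)

section Abelian

variable (k : Type u) [Field k] (C : Type u) [SmallCategory C] [Preadditive C] [Linear k C]

lemma isLinearFunctor_of_mono {F G : C ⥤ ModuleCat.{u} k} (i : F ⟶ G) [Mono i]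
    (hG : isLinearFunctor k C G) : isLinearFunctor k C F := by
  obtain ⟨_, _⟩ := hG
  refine ⟨⟨fun {X Y f g} => ?_⟩, ⟨fun {X Y} f r => ?_⟩⟩
  · rw [← cancel_mono (i.app Y)]; simp
  · rw [← cancel_mono (i.app Y)]; simp

lemma isLinearFunctor_of_epi {F G : C ⥤ ModuleCat.{u} k} (p : F ⟶ G) [Epi p]
    (hF : isLinearFunctor k C F) : isLinearFunctor k C G := by
  obtain ⟨_, _⟩ := hF
  refine ⟨⟨fun {X Y f g} => ?_⟩, ⟨fun {X Y} f r => ?_⟩⟩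
  · rw [← cancel_epi (p.app X)]; simp [← NatTrans.naturality]
  · rw [← cancel_epi (p.app X)]; simp [← NatTrans.naturality]

instance : (isLinearFunctor k C).IsClosedUnderSubobjects where
  prop_of_mono i _ h := isLinearFunctor_of_mono k C i h

instance : (isLinearFunctor k C).IsClosedUnderQuotients where
  prop_of_epi p _ h := isLinearFunctor_of_epi k C p h

lemma isLinearFunctor_of_isZero {F : C ⥤ ModuleCat.{u} k} (h : Limits.IsZero F) :
    isLinearFunctor k C F :=
  ⟨⟨(h.obj _).eq_of_src _ _⟩, ⟨fun _ _ => (h.obj _).eq_of_src _ _⟩⟩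

instance : (isLinearFunctor k C).ContainsZero where
  exists_zero := ⟨_, Limits.isZero_zero _, isLinearFunctor_of_isZero k C (Limits.isZero_zero _)⟩

instance : (isLinearFunctor k C).IsClosedUnderFiniteProducts where
  isClosedUnderLimitsOfShape J _ :=
    { limitsOfShape_le := by
        rintro G ⟨p⟩
        have hl (Y : C) := Limits.isLimitOfPreserves ((evaluation C (ModuleCat.{u} k)).obj Y)
          p.isLimit
        have h := p.prop_diag_obj
        refine ⟨⟨fun {X Y f g} => (hl Y).hom_ext fun j => ?_⟩,
          ⟨fun {X Y} f r => (hl Y).hom_ext fun j => ?_⟩⟩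
        · obtain ⟨_, _⟩ := h j
          simp
        · obtain ⟨_, _⟩ := h j
          simp }

/-- The category of modules is abelian and `k`-linear, so that its `Ext` groups are defined; they
are `k`-vector spaces, and `Ext⁰ = Hom`. -/
instance : HasExt.{u + 1} (LMod k C) := HasExt.standard _

end Abelian

section Restriction

variable (k : Type u) [Field k] {C C' D D' : Type u}
  [SmallCategory C] [Preadditive C] [Linear k C] [SmallCategory C'] [Preadditive C'] [Linear k C']
  [SmallCategory D] [Preadditive D] [Linear k D] [SmallCategory D'] [Preadditive D'] [Linear k D']

/-- Restriction of a `C'`-`D'`-bimodule along `k`-linear functors `F : C ⥤ C'` and `G : D ⥤ D'`: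
the `C`-`D`-bimodule with components `N (F a) (G b)`. -/
def Bimod.res (F : C ⥤ C') [F.Additive] [F.Linear k] (G : D ⥤ D') [G.Additive] [G.Linear k]
    (N : Bimod k C' D') : Bimod k C D where
  obj := TensorCat.map k F G.op ⋙ N.obj
  property := by
    obtain ⟨_, _⟩ := N.property
    exact ⟨inferInstance, ⟨fun f r => by
      change N.obj.map ((TensorCat.map k F G.op).map (r • f)) = _
      rw [Functor.map_smul, Functor.map_smul]; rfl⟩⟩

variable {k}

/-- The component of a bimodule `N` at `a`, `b`; covariant in `a`, contravariant in `b`. -/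
def Bimod.at (N : Bimod k C D) (a : C) (b : D) : ModuleCat.{u} k := N.obj.obj ⟨a, op b⟩

/-- The left action `n ↦ g · n` of a morphism `g : a ⟶ a'`, linear in `g` and in `n`. -/
def Bimod.lact (N : Bimod k C D) (a a' : C) (b : D) : (a ⟶ a') →ₗ[k] N.at a b →ₗ[k] N.at a' b where
  toFun g := (N.obj.map (tmulHom k a a' (op b) (op b) g (𝟙 _))).hom
  map_add' g g' := by
    obtain ⟨_, _⟩ := N.property
    rw [map_add, LinearMap.add_apply, Functor.map_add]; rfl
  map_smul' r g := by
    obtain ⟨_, _⟩ := N.property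
    rw [map_smul, LinearMap.smul_apply, Functor.map_smul]; rfl

/-- The right action `n ↦ n · h` of a morphism `h : b' ⟶ b`, linear in `h` and in `n`. -/
def Bimod.ract (N : Bimod k C D) (a : C) (b b' : D) : (b' ⟶ b) →ₗ[k] N.at a b →ₗ[k] N.at a b' where
  toFun h := (N.obj.map (tmulHom k a a (op b) (op b') (𝟙 a) h.op)).hom
  map_add' h h' := by
    obtain ⟨_, _⟩ := N.property
    rw [op_add, map_add, Functor.map_add]; rfl
  map_smul' r h := by
    obtain ⟨_, _⟩ := N.property
    change (N.obj.map (tmulHom k a a (op b) (op b') (𝟙 a) (r • h.op))).hom = _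
    rw [map_smul, Functor.map_smul]; rfl

lemma Bimod.lact_id (N : Bimod k C D) (a : C) (b : D) (n : N.at a b) :
    N.lact a a b (𝟙 a) n = n := by
  change (N.obj.map (𝟙 _)).hom n = n
  rw [N.obj.map_id]; rfl

lemma Bimod.ract_id (N : Bimod k C D) (a : C) (b : D) (n : N.at a b) :
    N.ract a b b (𝟙 b) n = n := by
  change (N.obj.map (𝟙 _)).hom n = n
  rw [N.obj.map_id]; rfl

lemma Bimod.lact_lact (N : Bimod k C D) {a₁ a₂ a₃ : C} (b : D) (g : a₁ ⟶ a₂) (g' : a₂ ⟶ a₃)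
    (n : N.at a₁ b) : N.lact _ _ b g' (N.lact _ _ b g n) = N.lact _ _ b (g ≫ g') n := by
  change (N.obj.map _ ≫ N.obj.map _).hom n = (N.obj.map _).hom n
  rw [← N.obj.map_comp, tmulHom_comp, Category.comp_id]

lemma Bimod.ract_ract (N : Bimod k C D) (a : C) {b₁ b₂ b₃ : D} (h : b₁ ⟶ b₂) (h' : b₂ ⟶ b₃)
    (n : N.at a b₃) : N.ract a _ _ h (N.ract a _ _ h' n) = N.ract a _ _ (h ≫ h') n := by
  change (N.obj.map _ ≫ N.obj.map _).hom n = (N.obj.map _).hom n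
  rw [← N.obj.map_comp, tmulHom_comp, Category.comp_id, op_comp]

lemma Bimod.lact_ract (N : Bimod k C D) {a a' : C} {b b' : D} (g : a ⟶ a') (h : b' ⟶ b)
    (n : N.at a b) :
    N.lact _ _ _ g (N.ract _ _ _ h n) = N.ract _ _ _ h (N.lact _ _ _ g n) := by
  change (N.obj.map _ ≫ N.obj.map _).hom n = (N.obj.map _ ≫ N.obj.map _).hom n
  rw [← N.obj.map_comp, ← N.obj.map_comp, tmulHom_comp, tmulHom_comp]
  simp

end Restriction

/-! ## The Hochschild-Mitchell complex -/

section Hochschild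

variable {k : Type u} [Field k] {C : Type u} [SmallCategory C] [Preadditive C] [Linear k C]

/-- For `F : C → Mod k`, the space
`∏_{x₁, …, xₙ} Hom_k (C(x₁, x₀) ⊗ C(x₂, x₁) ⊗ ⋯ ⊗ C(xₙ, xₙ₋₁), F xₙ)`
of families, indexed by the objects `x₁, …, xₙ`, of multilinear functions of `n` composable
morphisms `g₁ : x₁ ⟶ x₀, …, gₙ : xₙ ⟶ xₙ₋₁`, written in curried form
`∏_{x₁} Hom_k (C(x₁, x₀), ∏_{x₂} Hom_k (C(x₂, x₁), …))`. -/
@[reducible] def Multi (F : C → ModuleCat.{u} k) : ℕ → C → ModuleCat.{u} k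
  | 0, x₀ => F x₀
  | n + 1, x₀ => ModuleCat.of k (∀ x₁ : C, (x₁ ⟶ x₀) →ₗ[k] Multi F n x₁)

lemma Multi.ext {F : C → ModuleCat.{u} k} {n : ℕ} {x₀ : C} {φ ψ : Multi F (n + 1) x₀}
    (h : ∀ (x₁ : C) (g : x₁ ⟶ x₀), φ x₁ g = ψ x₁ g) : φ = ψ :=
  funext fun x₁ => LinearMap.ext fun g => h x₁ g

lemma Multi.add_apply {F : C → ModuleCat.{u} k} {n : ℕ} {x₀ : C} (φ ψ : Multi F (n + 1) x₀)
    (x₁ : C) (g : x₁ ⟶ x₀) : (φ + ψ) x₁ g = φ x₁ g + ψ x₁ g := rfl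

lemma Multi.sub_apply {F : C → ModuleCat.{u} k} {n : ℕ} {x₀ : C} (φ ψ : Multi F (n + 1) x₀)
    (x₁ : C) (g : x₁ ⟶ x₀) : (φ - ψ) x₁ g = φ x₁ g - ψ x₁ g := rfl

lemma Multi.smul_apply {F : C → ModuleCat.{u} k} {n : ℕ} {x₀ : C} (r : k)
    (φ : Multi F (n + 1) x₀) (x₁ : C) (g : x₁ ⟶ x₀) : (r • φ) x₁ g = r • φ x₁ g := rfl

/-- Composition of the values of a family with linear maps `η x : F x → F' x`; linear in `η`. -/
def Multi.post {F F' : C → ModuleCat.{u} k} :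
    ∀ (n : ℕ) (x₀ : C), (∀ x, F x →ₗ[k] F' x) →ₗ[k] Multi F n x₀ →ₗ[k] Multi F' n x₀
  | 0, x₀ => LinearMap.proj x₀
  | n + 1, x₀ => LinearMap.mk₂ k
      (fun η φ x₁ => Multi.post n x₁ η ∘ₗ φ x₁)
      (fun η η' φ => by funext x₁; exact LinearMap.ext fun g => by simp)
      (fun r η φ => by funext x₁; exact LinearMap.ext fun g => by simp)
      (fun η φ φ' => by funext x₁; exact LinearMap.ext fun g => map_add (Multi.post n x₁ η) _ _)
      (fun r η φ => by funext x₁; exact LinearMap.ext fun g => map_smul (Multi.post n x₁ η) _ _)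

lemma Multi.post_succ {F F' : C → ModuleCat.{u} k} (n : ℕ) (x₀ : C) (η : ∀ x, F x →ₗ[k] F' x)
    (φ : Multi F (n + 1) x₀) (x₁ : C) (g : x₁ ⟶ x₀) :
    Multi.post (n + 1) x₀ η φ x₁ g = Multi.post n x₁ η (φ x₁ g) := rfl

/-- The family `(g₂, …) ↦ φ(g₁ g₂, …)`, linear in `g₁` and in `φ`. -/
def Multi.comp {F : C → ModuleCat.{u} k} (n : ℕ) (x₀ x₁ : C) :
    (x₁ ⟶ x₀) →ₗ[k] Multi F (n + 1) x₀ →ₗ[k] Multi F (n + 1) x₁ :=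
  LinearMap.mk₂ k (fun g₁ φ x₂ => φ x₂ ∘ₗ Linear.rightComp k x₂ g₁)
    (fun g g' φ => by funext x₂; exact LinearMap.ext fun h => by simp)
    (fun r g φ => by funext x₂; exact LinearMap.ext fun h => by simp)
    (fun g φ φ' => rfl)
    (fun r g φ => rfl)

lemma Multi.comp_apply {F : C → ModuleCat.{u} k} (n : ℕ) {x₀ x₁ : C} (g₁ : x₁ ⟶ x₀)
    (φ : Multi F (n + 1) x₀) (x₂ : C) (g₂ : x₂ ⟶ x₁) :
    Multi.comp n x₀ x₁ g₁ φ x₂ g₂ = φ x₂ (g₂ ≫ g₁) := rfl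

/-- The part of the Hochschild-Mitchell differential that does not involve the left action, up to
the sign `-1`: for a right action `ρ` of `C` on `F`,
`(D φ)(g₁, …, gₙ₊₁) = ∑_{1 ≤ i ≤ n} (-1)ⁱ⁻¹ φ(g₁, …, gᵢ gᵢ₊₁, …, gₙ₊₁) + (-1)ⁿ φ(g₁, …, gₙ) · gₙ₊₁`,
defined by recursion on `n`:
`(D φ)(g₁, g₂, …) = φ(g₁ g₂, …) - (D (φ(g₁, ⋯)))(g₂, …)`.
Here `gᵢ gᵢ₊₁` is the composite `gᵢ₊₁ ≫ gᵢ`. -/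
def Multi.diff {F : C → ModuleCat.{u} k} (ρ : ∀ a b, (b ⟶ a) →ₗ[k] F a →ₗ[k] F b) :
    ∀ (n : ℕ) (x₀ : C), Multi F n x₀ →ₗ[k] Multi F (n + 1) x₀
  | 0, x₀ => LinearMap.pi fun x₁ => (ρ x₀ x₁).flip
  | n + 1, x₀ => LinearMap.pi fun x₁ => LinearMap.mk₂ k
      (fun φ g₁ => Multi.comp n x₀ x₁ g₁ φ - Multi.diff ρ n x₁ (φ x₁ g₁))
      (fun φ φ' g => by
        rw [Multi.add_apply, map_add, map_add, add_sub_add_comm])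
      (fun r φ g => by
        rw [Multi.smul_apply, map_smul, map_smul, smul_sub])
      (fun φ g g' => by
        rw [map_add, map_add, map_add, LinearMap.add_apply, add_sub_add_comm])
      (fun r φ g => by
        rw [map_smul, map_smul, map_smul, LinearMap.smul_apply, smul_sub])

lemma Multi.diff_zero {F : C → ModuleCat.{u} k} (ρ : ∀ a b, (b ⟶ a) →ₗ[k] F a →ₗ[k] F b)
    (x₀ : C) (φ : Multi F 0 x₀) (x₁ : C) (g₁ : x₁ ⟶ x₀) :
    Multi.diff ρ 0 x₀ φ x₁ g₁ = ρ x₀ x₁ g₁ φ := rfl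

lemma Multi.diff_succ {F : C → ModuleCat.{u} k} (ρ : ∀ a b, (b ⟶ a) →ₗ[k] F a →ₗ[k] F b)
    (n : ℕ) (x₀ : C) (φ : Multi F (n + 1) x₀) (x₁ : C) (g₁ : x₁ ⟶ x₀) :
    Multi.diff ρ (n + 1) x₀ φ x₁ g₁ = Multi.comp n x₀ x₁ g₁ φ - Multi.diff ρ n x₁ (φ x₁ g₁) := rfl

lemma Multi.diff_diff {F : C → ModuleCat.{u} k} (ρ : ∀ a b, (b ⟶ a) →ₗ[k] F a →ₗ[k] F b)
    (hρ : ∀ (a b c) (g : b ⟶ a) (h : c ⟶ b) (v), ρ b c h (ρ a b g v) = ρ a c (h ≫ g) v)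
    (n : ℕ) : ∀ (x₀ : C) (φ : Multi F n x₀),
      Multi.diff ρ (n + 1) x₀ (Multi.diff ρ n x₀ φ) = 0 := by
  induction n with
  | zero =>
    intro x₀ φ
    refine Multi.ext fun x₁ g => Multi.ext fun x₂ h => ?_
    rw [Multi.diff_succ, Multi.sub_apply, Multi.comp_apply, Multi.diff_zero, Multi.diff_zero,
      Multi.diff_zero, hρ, sub_self]
    rfl
  | succ n ih =>
    intro x₀ φ
    refine Multi.ext fun x₁ g => Multi.ext fun x₂ h => ?_
    rw [Multi.diff_succ, Multi.sub_apply, Multi.comp_apply, Multi.diff_succ, Multi.diff_succ,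
      Multi.diff_succ, Multi.sub_apply, map_sub, map_sub, Multi.comp_apply]
    have : Multi.comp n x₀ x₂ (h ≫ g) φ = Multi.comp n x₁ x₂ h (Multi.comp n x₀ x₁ g φ) :=
      Multi.ext fun x₃ l => by
        rw [Multi.comp_apply, Multi.comp_apply, Multi.comp_apply, Category.assoc]
    have e : Multi.comp n x₁ x₂ h (Multi.diff ρ n x₁ (φ x₁ g)) =
        Multi.diff ρ n x₂ (Multi.diff ρ n x₁ (φ x₁ g) x₂ h) := by
      rw [← sub_eq_zero, ← Multi.diff_succ, ih]
      rfl
    rw [this, e]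
    change _ = (0 : Multi F (n + 1) x₂)
    abel

lemma Multi.diff_post {F F' : C → ModuleCat.{u} k} (ρ : ∀ a b, (b ⟶ a) →ₗ[k] F a →ₗ[k] F b)
    (ρ' : ∀ a b, (b ⟶ a) →ₗ[k] F' a →ₗ[k] F' b) (η : ∀ x, F x →ₗ[k] F' x)
    (hη : ∀ (a b) (g : b ⟶ a) (v), ρ' a b g (η a v) = η b (ρ a b g v)) (n : ℕ) :
    ∀ (x₀ : C) (φ : Multi F n x₀),
      Multi.diff ρ' n x₀ (Multi.post n x₀ η φ) = Multi.post (n + 1) x₀ η (Multi.diff ρ n x₀ φ) := by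
  induction n with
  | zero => exact fun x₀ φ => Multi.ext fun x₁ g => hη _ _ _ _
  | succ n ih =>
    intro x₀ φ
    refine Multi.ext fun x₁ g => ?_
    rw [Multi.diff_succ, Multi.post_succ, Multi.post_succ, ih, Multi.diff_succ, map_sub]
    rfl

lemma Multi.post_post {F F' F'' : C → ModuleCat.{u} k} (η : ∀ x, F x →ₗ[k] F' x)
    (η' : ∀ x, F' x →ₗ[k] F'' x) (n : ℕ) : ∀ (x₀ : C) (φ : Multi F n x₀),
      Multi.post n x₀ η' (Multi.post n x₀ η φ) = Multi.post n x₀ (fun x => η' x ∘ₗ η x) φ := by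
  induction n with
  | zero => exact fun x₀ φ => rfl
  | succ n ih => exact fun x₀ φ => Multi.ext fun x₁ g => ih _ _

variable (N : Bimod k C C)

/-- The differential of the Hochschild-Mitchell cochain complex:
`(d φ)(g₁, …, gₙ₊₁) = g₁ · φ(g₂, …, gₙ₊₁) + ∑_{1 ≤ i ≤ n} (-1)ⁱ φ(g₁, …, gᵢ gᵢ₊₁, …, gₙ₊₁)
  + (-1)ⁿ⁺¹ φ(g₁, …, gₙ) · gₙ₊₁`. -/
def hmDiff (n : ℕ) :
    (∀ x₀ : C, Multi (N.at x₀) n x₀) →ₗ[k] (∀ x₀ : C, Multi (N.at x₀) (n + 1) x₀) where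
  toFun φ x₀ :=
    (show Multi (N.at x₀) (n + 1) x₀ from fun x₁ =>
      (Multi.post n x₁).flip (φ x₁) ∘ₗ LinearMap.pi fun c => N.lact x₁ x₀ c) -
    Multi.diff (N.ract x₀) n x₀ (φ x₀)
  map_add' φ φ' := funext fun x₀ => Multi.ext fun x₁ g => by
    change Multi.post n x₁ (fun c => N.lact x₁ x₀ c g) (φ x₁ + φ' x₁) -
      Multi.diff (N.ract x₀) n x₀ (φ x₀ + φ' x₀) x₁ g = _
    rw [map_add, map_add, Multi.add_apply, add_sub_add_comm]
    rfl
  map_smul' r φ := funext fun x₀ => Multi.ext fun x₁ g => by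
    change Multi.post n x₁ (fun c => N.lact x₁ x₀ c g) (r • φ x₁) -
      Multi.diff (N.ract x₀) n x₀ (r • φ x₀) x₁ g = _
    rw [map_smul, map_smul, Multi.smul_apply, ← smul_sub]
    rfl

lemma hmDiff_apply (n : ℕ) (φ : ∀ x₀ : C, Multi (N.at x₀) n x₀) (x₀ x₁ : C) (g : x₁ ⟶ x₀) :
    hmDiff N n φ x₀ x₁ g = Multi.post n x₁ (fun c => N.lact x₁ x₀ c g) (φ x₁) -
      Multi.diff (N.ract x₀) n x₀ (φ x₀) x₁ g := rfl

/-- In degree `0`: `(d φ)(g) = g · φ - φ · g`. -/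
lemma hmDiff_zero_apply (φ : ∀ x₀ : C, Multi (N.at x₀) 0 x₀) (x₀ x₁ : C) (g : x₁ ⟶ x₀) :
    hmDiff N 0 φ x₀ x₁ g = N.lact x₁ x₀ x₁ g (φ x₁) - N.ract x₀ x₀ x₁ g (φ x₀) := rfl

/-- In degree `1`: `(d φ)(g, h) = g · φ(h) - φ(g h) + φ(g) · h`. -/
lemma hmDiff_one_apply (φ : ∀ x₀ : C, Multi (N.at x₀) 1 x₀) (x₀ x₁ x₂ : C) (g : x₁ ⟶ x₀)
    (h : x₂ ⟶ x₁) :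
    (show Multi (N.at x₀) 1 x₁ from hmDiff N 1 φ x₀ x₁ g) x₂ h =
      N.lact x₁ x₀ x₂ g (φ x₁ x₂ h) - φ x₀ x₂ (h ≫ g) + N.ract x₀ x₁ x₂ h (φ x₀ x₁ g) :=
  (sub_sub_eq_add_sub _ _ _).trans (add_sub_right_comm _ _ _)

lemma hmDiff_hmDiff (n : ℕ) (φ : ∀ x₀ : C, Multi (N.at x₀) n x₀) :
    hmDiff N (n + 1) (hmDiff N n φ) = 0 := by
  refine funext fun x₀ => Multi.ext fun x₁ g => Multi.ext fun x₂ h => ?_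
  have e : hmDiff N n φ x₀ x₁ g = Multi.post n x₁ (fun c => N.lact x₁ x₀ c g) (φ x₁) -
      Multi.diff (N.ract x₀) n x₀ (φ x₀) x₁ g := rfl
  have hD : Multi.comp n x₀ x₁ g (Multi.diff (N.ract x₀) n x₀ (φ x₀)) =
      Multi.diff (N.ract x₀) n x₁ (Multi.diff (N.ract x₀) n x₀ (φ x₀) x₁ g) := by
    rw [← sub_eq_zero, ← Multi.diff_succ, Multi.diff_diff]
    · rfl
    · exact fun a b c g h v => N.ract_ract _ h g v
  have hP : Multi.diff (N.ract x₀) n x₁ (Multi.post n x₁ (fun c => N.lact x₁ x₀ c g) (φ x₁)) =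
      Multi.post (n + 1) x₁ (fun c => N.lact x₁ x₀ c g) (Multi.diff (N.ract x₁) n x₁ (φ x₁)) :=
    Multi.diff_post _ _ _ (fun a b h v => (N.lact_ract g h v).symm) _ _ _
  have hL : Multi.post n x₂ (fun c => N.lact x₂ x₀ c (h ≫ g)) (φ x₂) =
      Multi.post n x₂ (fun c => N.lact x₁ x₀ c g)
        (Multi.post n x₂ (fun c => N.lact x₂ x₁ c h) (φ x₂)) := by
    rw [Multi.post_post]
    congr 2
    exact funext fun c => LinearMap.ext fun v => (N.lact_lact _ _ _ _).symm
  rw [hmDiff_apply, Multi.diff_succ, e, map_sub, Multi.sub_apply, Multi.sub_apply,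
    Multi.sub_apply, Multi.comp_apply, Multi.post_succ, hmDiff_apply, hmDiff_apply, map_sub,
    ← hD, Multi.comp_apply, hP, Multi.post_succ, hL]
  change _ = (0 : Multi (N.at x₀) n x₂)
  abel

/-- The Hochschild-Mitchell cochain complex of `C` with coefficients in the bimodule `N`; its term
of degree `n` is `∏_{x₀, …, xₙ} Hom_k (C(x₁, x₀) ⊗ ⋯ ⊗ C(xₙ, xₙ₋₁), N(x₀, xₙ))`. -/
def hmComplex : CochainComplex (ModuleCat.{u} k) ℕ :=
  CochainComplex.of (fun n => ModuleCat.of k (∀ x₀ : C, Multi (N.at x₀) n x₀))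
    (fun n => ModuleCat.ofHom (hmDiff N n))
    (fun n => by ext φ : 2; exact hmDiff_hmDiff N n φ)

lemma hmComplex_d (n : ℕ) : (hmComplex N).d n (n + 1) = ModuleCat.ofHom (hmDiff N n) := by
  simp [hmComplex, CochainComplex.of]

/-- Hochschild-Mitchell cohomology `Hⁿ(C, N)`. -/
abbrev hmCohomology (n : ℕ) : ModuleCat.{u} k := (hmComplex N).homology n

end Hochschild

section HochschildRestriction

variable {k : Type u} [Field k] {C D : Type u} [SmallCategory C] [Preadditive C] [Linear k C]
  [SmallCategory D] [Preadditive D] [Linear k D] (G : D ⥤ C) [G.Additive] [G.Linear k]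

/-- Restriction of a family of multilinear functions along a functor. -/
def Multi.restrict (F : C → ModuleCat.{u} k) :
    ∀ (n : ℕ) (x₀ : D), Multi F n (G.obj x₀) →ₗ[k] Multi (fun x => F (G.obj x)) n x₀
  | 0, _ => LinearMap.id
  | n + 1, _ => LinearMap.pi fun x₁ =>
      { toFun := fun φ => Multi.restrict F n x₁ ∘ₗ φ (G.obj x₁) ∘ₗ G.mapLinearMap k
        map_add' := fun _ _ => LinearMap.ext fun _ => map_add (Multi.restrict F n x₁) _ _
        map_smul' := fun _ _ => LinearMap.ext fun _ => map_smul (Multi.restrict F n x₁) _ _ }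

lemma Multi.restrict_succ (F : C → ModuleCat.{u} k) (n : ℕ) (x₀ : D)
    (φ : Multi F (n + 1) (G.obj x₀)) (x₁ : D) (g : x₁ ⟶ x₀) :
    Multi.restrict G F (n + 1) x₀ φ x₁ g = Multi.restrict G F n x₁ (φ (G.obj x₁) (G.map g)) := rfl

lemma Multi.diff_restrict {F : C → ModuleCat.{u} k} (ρ : ∀ a b, (b ⟶ a) →ₗ[k] F a →ₗ[k] F b)
    (ρ' : ∀ a b : D, (b ⟶ a) →ₗ[k] F (G.obj a) →ₗ[k] F (G.obj b))
    (hρ : ∀ (a b : D) (g : b ⟶ a), ρ' a b g = ρ _ _ (G.map g)) (n : ℕ) :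
    ∀ (x₀ : D) (φ : Multi F n (G.obj x₀)),
      Multi.diff (F := fun x => F (G.obj x)) ρ' n x₀ (Multi.restrict G F n x₀ φ) =
        Multi.restrict G F (n + 1) x₀ (Multi.diff ρ n (G.obj x₀) φ) := by
  induction n with
  | zero =>
    refine fun x₀ φ => Multi.ext fun x₁ g => ?_
    rw [Multi.diff_zero, hρ]
    rfl
  | succ n ih =>
    intro x₀ φ
    refine Multi.ext fun x₁ g => ?_
    rw [Multi.diff_succ, Multi.restrict_succ, ih, Multi.restrict_succ, Multi.diff_succ, map_sub]
    congr 1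
    refine Multi.ext fun x₂ h => ?_
    rw [Multi.comp_apply, Multi.restrict_succ, Multi.restrict_succ, Multi.comp_apply, G.map_comp]

lemma Multi.post_restrict {F F' : C → ModuleCat.{u} k} (η : ∀ x, F x →ₗ[k] F' x) (n : ℕ) :
    ∀ (x₀ : D) (φ : Multi F n (G.obj x₀)),
      Multi.post (F := fun x => F (G.obj x)) (F' := fun x => F' (G.obj x)) n x₀
          (fun x => η (G.obj x)) (Multi.restrict G F n x₀ φ) =
        Multi.restrict G F' n x₀ (Multi.post n (G.obj x₀) η φ) := by
  induction n with
  | zero => exact fun x₀ φ => rfl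
  | succ n ih => exact fun x₀ φ => Multi.ext fun x₁ g => ih _ _

variable (N : Bimod k C C)

/-- Restriction of Hochschild-Mitchell cochains along a functor. -/
def hmRestrictLinear (n : ℕ) :
    (∀ x₀ : C, Multi (N.at x₀) n x₀) →ₗ[k] (∀ x₀ : D, Multi ((N.res k G G).at x₀) n x₀) :=
  LinearMap.pi fun x₀ => Multi.restrict G (N.at (G.obj x₀)) n x₀ ∘ₗ LinearMap.proj (G.obj x₀)

lemma Bimod.res_lact (a a' b : D) (g : a ⟶ a') :
    (N.res k G G).lact a a' b g = N.lact (G.obj a) (G.obj a') (G.obj b) (G.map g) := by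
  change (N.obj.map (tmulHom k _ _ (op (G.obj b)) (op (G.obj b)) (G.map g) (G.op.map (𝟙 _)))).hom = _
  rw [G.op.map_id]
  rfl

lemma Bimod.res_ract (a b b' : D) (h : b' ⟶ b) :
    (N.res k G G).ract a b b' h = N.ract (G.obj a) (G.obj b) (G.obj b') (G.map h) := by
  change (N.obj.map (tmulHom k _ _ (op (G.obj b)) (op (G.obj b')) (G.map (𝟙 a)) (G.map h).op)).hom
    = _
  rw [G.map_id]
  rfl

lemma hmDiff_hmRestrictLinear (n : ℕ) (φ : ∀ x₀ : C, Multi (N.at x₀) n x₀) :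
    hmDiff (N.res k G G) n (hmRestrictLinear G N n φ) =
      hmRestrictLinear G N (n + 1) (hmDiff N n φ) := by
  refine funext fun x₀ => Multi.ext fun x₁ g => ?_
  have h₁ := Multi.diff_restrict G (N.ract (G.obj x₀)) ((N.res k G G).ract x₀)
    (fun a b g => Bimod.res_ract G N _ _ _ g) n x₀ (φ (G.obj x₀))
  have h₂ := Multi.post_restrict G (fun c => N.lact (G.obj x₁) (G.obj x₀) c (G.map g)) n x₁
    (φ (G.obj x₁))
  have h₃ : (fun c => (N.res k G G).lact x₁ x₀ c g) =
    fun c => N.lact (G.obj x₁) (G.obj x₀) (G.obj c) (G.map g) :=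
    funext fun c => Bimod.res_lact G N _ _ _ _
  rw [hmDiff_apply, h₃]
  change _ = Multi.restrict G _ n x₁ (hmDiff N n φ (G.obj x₀) (G.obj x₁) (G.map g))
  rw [hmDiff_apply, map_sub]
  exact congrArg₂ (fun a b : Multi (fun x => N.at (G.obj x₀) (G.obj x)) n x₁ => a - b) h₂
    (DFunLike.congr_fun (congrFun h₁ x₁) g)

/-- The restriction `C^•(C, N) ⟶ C^•(D, N|_D)` of Hochschild-Mitchell complexes along a functor
`D ⥤ C`. -/
def hmRestrict : hmComplex N ⟶ hmComplex (N.res k G G) :=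
  CochainComplex.ofHom (fun n => ModuleCat.ofHom (hmRestrictLinear G N n))
    (fun n => by
      rw [hmComplex_d, hmComplex_d]
      ext φ : 2
      exact hmDiff_hmRestrictLinear G N n φ)

/-- The map `Hⁿ(C, N) → Hⁿ(D, N|_D)` induced by the restriction of cochains. -/
def hmRes (n : ℕ) : hmCohomology N n →ₗ[k] hmCohomology (N.res k G G) n :=
  (HomologicalComplex.homologyMap (hmRestrict G N) n).hom

end HochschildRestriction

/-! ## The glued category -/

section Glue

variable {k : Type u} [Field k] {C₁ C₂ : Type u} [SmallCategory C₁] [Preadditive C₁] [Linear k C₁]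
  [SmallCategory C₂] [Preadditive C₂] [Linear k C₂]

/-- Objects of `C₁ ⊔_M C₂`: the disjoint union of the objects of `C₁` and of `C₂`. -/
inductive Glue (M : Bimod k C₁ C₂) : Type u
  | inl (x : C₁) : Glue M
  | inr (y : C₂) : Glue M

namespace Glue

variable (M : Bimod k C₁ C₂)

/-- The space of morphisms from `X` to `Y` in `C₁ ⊔_M C₂`. -/
def homMod : Glue M → Glue M → ModuleCat.{u} k
  | inl x, inl x' => ModuleCat.of k (x ⟶ x')
  | inr y, inr y' => ModuleCat.of k (y ⟶ y')
  | inr y, inl x => M.at x y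
  | inl _, inr _ => ModuleCat.of k PUnit

/-- The composition of `C₁ ⊔_M C₂` (in diagrammatic order), given by the compositions of `C₁` and
`C₂` and by the actions on `M`. -/
def compMod : ∀ X Y Z : Glue M, homMod M X Y →ₗ[k] homMod M Y Z →ₗ[k] homMod M X Z
  | inl x, inl y, inl z => Linear.comp (S := k) x y z
  | inr x, inr y, inr z => Linear.comp (S := k) x y z
  | inr x, inl y, inl z => (M.lact y z x).flip
  | inr x, inr y, inl z => M.ract z y x
  | inl _, inr _, _ => 0
  | _, inl _, inr _ => 0

/-- The identities of `C₁ ⊔_M C₂`. -/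
def idMod : ∀ X : Glue M, homMod M X X
  | inl x => 𝟙 x
  | inr y => 𝟙 y

instance : SmallCategory (Glue M) where
  Hom X Y := homMod M X Y
  id X := idMod M X
  comp {X Y Z} f g := compMod M X Y Z f g
  id_comp {X Y} f := by
    cases X <;> cases Y
    · exact Category.id_comp (obj := C₁) f
    · rfl
    · exact M.ract_id _ _ f
    · exact Category.id_comp (obj := C₂) f
  comp_id {X Y} f := by
    cases X <;> cases Y
    · exact Category.comp_id (obj := C₁) f
    · rfl
    · exact M.lact_id _ _ f
    · exact Category.comp_id (obj := C₂) f
  assoc {W X Y Z} f g h := by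
    cases W <;> cases X <;> cases Y <;> cases Z
    · exact Category.assoc (obj := C₁) f g h
    · rfl
    · exact (map_zero (Linear.comp (S := k) _ _ _ f)).symm
    · rfl
    · exact LinearMap.map_zero₂ (Linear.comp (S := k) _ _ _) h
    · rfl
    · rfl
    · rfl
    · exact M.lact_lact _ g h f
    · rfl
    · exact (LinearMap.map_zero₂ (M.ract _ _ _) h).trans
        (map_zero ((M.lact _ _ _).flip f)).symm
    · exact LinearMap.map_zero₂ (Linear.comp (S := k) _ _ _) h
    · exact M.lact_ract h f g
    · exact (map_zero (Linear.comp (S := k) _ _ _ f)).symm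
    · exact (M.ract_ract _ f g h).symm
    · exact Category.assoc (obj := C₂) f g h

instance : Preadditive (Glue M) where
  homGroup X Y := inferInstanceAs (AddCommGroup (homMod M X Y))
  add_comp X Y Z f f' g := by
    change compMod M X Y Z (HAdd.hAdd (α := homMod M X Y) f f') g = _
    rw [map_add]; rfl
  comp_add X Y Z f g g' := by
    change compMod M X Y Z f (HAdd.hAdd (α := homMod M Y Z) g g') = _
    rw [map_add]; rfl

instance : Linear k (Glue M) where
  homModule X Y := inferInstanceAs (Module k (homMod M X Y))
  smul_comp X Y Z r f g := by
    change compMod M X Y Z (HSMul.hSMul (β := homMod M X Y) r f) g = _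
    rw [map_smul]; rfl
  comp_smul X Y Z f r g := by
    change compMod M X Y Z f (HSMul.hSMul (β := homMod M Y Z) r g) = _
    rw [map_smul]; rfl

/-- The inclusion of `C₁` in `C₁ ⊔_M C₂`. -/
def incl₁ : C₁ ⥤ Glue M where
  obj x := inl x
  map f := f

/-- The inclusion of `C₂` in `C₁ ⊔_M C₂`. -/
def incl₂ : C₂ ⥤ Glue M where
  obj y := inr y
  map f := f

instance : (incl₁ M).Additive where
  map_add := rfl

instance : (incl₁ M).Linear k where
  map_smul _ _ := rfl

instance : (incl₂ M).Additive where
  map_add := rfl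

instance : (incl₂ M).Linear k where
  map_smul _ _ := rfl

variable {M}

/-- The restriction of a bimodule over `C₁ ⊔_M C₂` to a `C₁`-bimodule. -/
abbrev r₁ (N : Bimod k (Glue M) (Glue M)) : Bimod k C₁ C₁ := N.res k (incl₁ M) (incl₁ M)

/-- The restriction of a bimodule over `C₁ ⊔_M C₂` to a `C₂`-bimodule. -/
abbrev r₂ (N : Bimod k (Glue M) (Glue M)) : Bimod k C₂ C₂ := N.res k (incl₂ M) (incl₂ M)

/-- The restriction of a bimodule over `C₁ ⊔_M C₂` to a `C₁`-`C₂`-bimodule. -/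
abbrev r₁₂ (N : Bimod k (Glue M) (Glue M)) : Bimod k C₁ C₂ := N.res k (incl₁ M) (incl₂ M)

/-- The map `Hⁿ(C₁ ⊔_M C₂, N) → Hⁿ(C₁, r₁ N) ⊕ Hⁿ(C₂, r₂ N)` induced by restricting cochains. -/
def res (N : Bimod k (Glue M) (Glue M)) (n : ℕ) :
    hmCohomology N n →ₗ[k] hmCohomology (r₁ N) n × hmCohomology (r₂ N) n :=
  (hmRes (incl₁ M) N n).prod (hmRes (incl₂ M) N n)

end Glue

end Glue

end HM

end

noncomputable section

namespace HM

/-! ## Bimodules in terms of their two actions -/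

section BimodActions

variable {k : Type u} [Field k] {C D : Type u} [SmallCategory C] [Preadditive C] [Linear k C]
  [SmallCategory D] [Preadditive D] [Linear k D]

/-! Write `K(N)` for the complex of cochains of `C₁ ⊔_M C₂` that vanish on `C₁` and on `C₂`.
Restriction of cochains to the two pieces is surjective in each degree (extend by zero), so `0 →
K(N) → C(C, N) → C(C₁, r₁ N) ⊕ C(C₂, r₂ N) → 0` is a short exact sequence of complexes. Its long
exact cohomology sequence is the required one as soon as `H^{n+1}(K(N)) ≅ Extⁿ(M, r₁₂ N)`; this is
`nonempty_relCohomology_equiv_ext`.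

That isomorphism is built by induction on `n`, by dimension shifting in `N`. For `n = 0`: `K(N)` is
zero in degree `0`, and a relative `1`-cochain is a linear map on `M` whose cocycle condition says
exactly that it commutes with both actions. Hence `H¹(K(N)) = Hom(M, r₁₂ N)`, naturally in `N`.

For the induction step, embed `N` in the coinduced bimodule `I`, with components `I(x, y) = ∏_{a,b}
Hom_k(C(x, a) ⊗ C(b, y), N(a, b))`, and let `Q` be the quotient. Since `k` is a field, `K` is exact
in the coefficients, and so is `r₁₂`. There are no nonzero morphisms from objects of `C₁` to objects
of `C₂`; therefore `r₁ I` is still coinduced on the left, `r₂ I` is coinduced on the right, and `r₁₂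
I` is coinduced on both sides. One-sided coinduction makes Hochschild-Mitchell cohomology vanish in
positive degrees (`hmCohomology_isZero_of_left`, `hmCohomology_isZero_of_right`), hence
`H^{n+2}(K(I)) = 0`; two-sided coinduction makes `r₁₂ I` injective (`injective_r₁₂_coind`), so its
higher `Ext` vanishes. Both `H^{n+2}(K(N))` and `Ext^{n+1}(M, r₁₂ N)` are then the cokernel of the
map from the `I`-term to the `Q`-term one step below. Naturality of the comparison is needed only at
the first step, because afterwards the `I`-terms are zero. -/

lemma TensorCat.hom_induction {X Y : TensorCat k C D} {P : (X ⟶ Y) → Prop} (f : X ⟶ Y)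
    (zero : P 0) (tmul : ∀ (g : X.fst ⟶ Y.fst) (h : X.snd ⟶ Y.snd), P (tmulHom k _ _ _ _ g h))
    (add : ∀ f f' : X ⟶ Y, P f → P f' → P (f + f')) : P f :=
  TensorProduct.induction_on (motive := P) f zero tmul add

/-- Since `g ⊗ h = (1 ⊗ h) ≫ (g ⊗ 1)`, a bimodule is determined by its two commuting actions;
everything below is checked on these rather than on tensors. -/
lemma Bimod.map_tmulHom (N : Bimod k C D) {a a' : C} {b b' : D} (g : a ⟶ a') (h : b' ⟶ b)
    (n : N.at a b) :
    (N.obj.map (tmulHom k a a' (op b) (op b') g h.op)).hom n =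
      N.lact a a' b' g (N.ract a b b' h n) := by
  change _ = (N.obj.map _ ≫ N.obj.map _).hom n
  rw [← N.obj.map_comp, tmulHom_comp, Category.id_comp, Category.comp_id]

/-- The component of a morphism of bimodules at `a`, `b`. -/
def Bimod.homAt {N N' : Bimod k C D} (f : N ⟶ N') (a : C) (b : D) : N.at a b →ₗ[k] N'.at a b :=
  (f.hom.app ⟨a, op b⟩).hom

lemma Bimod.homAt_lact {N N' : Bimod k C D} (f : N ⟶ N') {a a' : C} (b : D) (g : a ⟶ a')
    (n : N.at a b) : homAt f a' b (N.lact a a' b g n) = N'.lact a a' b g (homAt f a b n) :=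
  congr($(f.hom.naturality (tmulHom k a a' (op b) (op b) g (𝟙 _))).hom n)

lemma Bimod.homAt_ract {N N' : Bimod k C D} (f : N ⟶ N') (a : C) {b b' : D} (h : b' ⟶ b)
    (n : N.at a b) : homAt f a b' (N.ract a b b' h n) = N'.ract a b b' h (homAt f a b n) :=
  congr($(f.hom.naturality (tmulHom k a a (op b) (op b') (𝟙 _) h.op)).hom n)

@[simp]
lemma Bimod.homAt_comp {N N' N'' : Bimod k C D} (f : N ⟶ N') (g : N' ⟶ N'') (a : C) (b : D)
    (n : N.at a b) : homAt (f ≫ g) a b n = homAt g a b (homAt f a b n) := rfl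

lemma Bimod.hom_ext {N N' : Bimod k C D} {f g : N ⟶ N'}
    (h : ∀ a b n, homAt f a b n = homAt g a b n) : f = g :=
  ObjectProperty.hom_ext _ (NatTrans.ext (funext fun X => ModuleCat.hom_ext
    (LinearMap.ext fun n => h X.fst X.snd.unop n)))

/-- A morphism of bimodules from linear maps that commute with the two actions. -/
def Bimod.homMk {N N' : Bimod k C D} (η : ∀ a b, N.at a b →ₗ[k] N'.at a b)
    (hl : ∀ {a a' : C} (b : D) (g : a ⟶ a') (n : N.at a b),
      η a' b (N.lact a a' b g n) = N'.lact a a' b g (η a b n))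
    (hr : ∀ (a : C) {b b' : D} (h : b' ⟶ b) (n : N.at a b),
      η a b' (N.ract a b b' h n) = N'.ract a b b' h (η a b n)) : N ⟶ N' :=
  ObjectProperty.homMk
    { app := fun X => ModuleCat.ofHom (η X.fst X.snd.unop)
      naturality := fun X Y f => by
        obtain ⟨_, _⟩ := N.property
        obtain ⟨_, _⟩ := N'.property
        induction f using TensorCat.hom_induction with
        | zero => simp
        | add f f' hf hf' => simp [hf, hf']
        | tmul g h =>
          refine ModuleCat.hom_ext (LinearMap.ext fun n => ?_)
          change η Y.fst Y.snd.unop ((N.obj.map (tmulHom k X.fst Y.fst (op X.snd.unop)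
            (op Y.snd.unop) g h.unop.op)).hom n) = (N'.obj.map (tmulHom k X.fst Y.fst
            (op X.snd.unop) (op Y.snd.unop) g h.unop.op)).hom (η X.fst X.snd.unop n)
          exact (congrArg (η Y.fst Y.snd.unop) (N.map_tmulHom _ _ _)).trans ((hl _ _ _).trans
            ((congrArg _ (hr _ _ _)).trans (N'.map_tmulHom _ _ _).symm)) }

section OfActions

variable (F : C → D → ModuleCat.{u} k) (l : ∀ a a' b, (a ⟶ a') →ₗ[k] F a b →ₗ[k] F a' b)
  (r : ∀ a b b', (b' ⟶ b) →ₗ[k] F a b →ₗ[k] F a b')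

/-- The linear map by which the morphisms of `C ⊠ Dᵒᵖ` act, given the two actions. -/
def Bimod.actionMap (X Y : TensorCat k C Dᵒᵖ) :
    (X ⟶ Y) →ₗ[k] F X.fst X.snd.unop →ₗ[k] F Y.fst Y.snd.unop :=
  TensorProduct.lift (LinearMap.mk₂ k
    (fun (g : X.fst ⟶ Y.fst) (h : X.snd ⟶ Y.snd) => l _ _ _ g ∘ₗ r _ _ _ h.unop)
    (fun g g' h => by rw [map_add, LinearMap.add_comp])
    (fun c g h => by rw [map_smul, LinearMap.smul_comp])
    (fun g h h' => by rw [unop_add, map_add, LinearMap.comp_add])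
    (fun c g h => by
      change _ ∘ₗ r _ _ _ (c • h.unop) = _
      rw [map_smul, LinearMap.comp_smul]))

lemma Bimod.actionMap_tmulHom (X Y : TensorCat k C Dᵒᵖ) (g : X.fst ⟶ Y.fst)
    (h : X.snd ⟶ Y.snd) :
    actionMap F l r X Y (tmulHom k _ _ _ _ g h) = l _ _ _ g ∘ₗ r _ _ _ h.unop :=
  TensorProduct.lift.tmul _ _

variable (l_id : ∀ a b n, l a a b (𝟙 a) n = n) (r_id : ∀ a b n, r a b b (𝟙 b) n = n)
    (l_l : ∀ {a₁ a₂ a₃ : C} (b : D) (g : a₁ ⟶ a₂) (g' : a₂ ⟶ a₃) (n : F a₁ b),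
      l _ _ b g' (l _ _ b g n) = l _ _ b (g ≫ g') n)
    (r_r : ∀ (a : C) {b₁ b₂ b₃ : D} (h : b₁ ⟶ b₂) (h' : b₂ ⟶ b₃) (n : F a b₃),
      r a _ _ h (r a _ _ h' n) = r a _ _ (h ≫ h') n)
    (l_r : ∀ {a a' : C} {b b' : D} (g : a ⟶ a') (h : b' ⟶ b) (n : F a b),
      l _ _ _ g (r _ _ _ h n) = r _ _ _ h (l _ _ _ g n))

/-- The functor underlying `Bimod.ofActions`. -/
def Bimod.ofActionsFunctor : TensorCat k C Dᵒᵖ ⥤ ModuleCat.{u} k where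
  obj := fun X => F X.fst X.snd.unop
  map := fun {X Y} f => ModuleCat.ofHom (actionMap F l r X Y f)
  map_id := fun X => by
    refine ModuleCat.hom_ext (LinearMap.ext fun n => ?_)
    rw [← tmulHom_id (k := k)]
    change actionMap F l r X X _ n = n
    rw [actionMap_tmulHom]
    change l _ _ _ (𝟙 _) (r _ _ _ (𝟙 _) n) = n
    rw [r_id, l_id]
  map_comp := fun {X Y Z} f f' => by
    induction f using TensorCat.hom_induction with
    | zero => simp
    | add f₁ f₂ h₁ h₂ =>
      rw [Preadditive.add_comp, map_add, ModuleCat.ofHom_add, h₁, h₂, map_add,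
        ModuleCat.ofHom_add, Preadditive.add_comp]
    | tmul g h =>
      induction f' using TensorCat.hom_induction with
      | zero => simp
      | add f₁ f₂ h₁ h₂ =>
        rw [Preadditive.comp_add, map_add, ModuleCat.ofHom_add, h₁, h₂, map_add,
          ModuleCat.ofHom_add, Preadditive.comp_add]
      | tmul g' h' =>
        refine ModuleCat.hom_ext (LinearMap.ext fun n => ?_)
        have e : tmulHom k _ _ _ _ g h ≫ tmulHom k _ _ _ _ g' h' =
          tmulHom k _ _ _ _ (g ≫ g') (h ≫ h') := tmulHom_comp k g g' h h'
        refine congr($(congrArg (actionMap F l r X Z) e) n).trans ?_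
        rw [ModuleCat.hom_comp, ModuleCat.hom_ofHom, ModuleCat.hom_ofHom]
        rw [actionMap_tmulHom, actionMap_tmulHom, actionMap_tmulHom]
        change l _ _ _ (g ≫ g') (r _ _ _ (h'.unop ≫ h.unop) n) =
          l _ _ _ g' (r _ _ _ h'.unop (l _ _ _ g (r _ _ _ h.unop n)))
        rw [← l_r, r_r, l_l]

/-- The bimodule with given components and given left and right actions. -/
def Bimod.ofActions : Bimod k C D where
  obj := ofActionsFunctor F l r l_id r_id l_l r_r l_r
  property := ⟨⟨fun {X Y f g} =>
      congrArg ModuleCat.ofHom (map_add (actionMap F l r X Y) f g)⟩,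
    ⟨fun {X Y} f c => congrArg ModuleCat.ofHom (map_smul (actionMap F l r X Y) c f)⟩⟩

lemma Bimod.ofActions_lact (a a' : C) (b : D) (g : a ⟶ a') :
    (ofActions F l r l_id r_id l_l r_r l_r).lact a a' b g = l a a' b g := by
  change actionMap F l r ⟨a, op b⟩ ⟨a', op b⟩ (tmulHom k _ _ _ _ g (𝟙 _)) = _
  rw [actionMap_tmulHom]
  exact LinearMap.ext fun n => congrArg _ (r_id a b n)

lemma Bimod.ofActions_ract (a : C) (b b' : D) (h : b' ⟶ b) :
    (ofActions F l r l_id r_id l_l r_r l_r).ract a b b' h = r a b b' h := by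
  change actionMap F l r ⟨a, op b⟩ ⟨a, op b'⟩ (tmulHom k _ _ _ _ (𝟙 _) h.op) = _
  rw [actionMap_tmulHom]
  exact LinearMap.ext fun n => l_id a b' _

end OfActions

end BimodActions

/-! ## Exactness of sequences of bimodules -/

section BimodExact

variable {k : Type u} [Field k] {C D : Type u} [SmallCategory C] [Preadditive C] [Linear k C]
  [SmallCategory D] [Preadditive D] [Linear k D]

instance (E : Type u) [SmallCategory E] [Preadditive E] [Linear k E] :
    (isLinearFunctor k E).ι.PreservesMonomorphisms :=
  ObjectProperty.preservesMonomorphisms_ι_of_isNormalEpiCategory _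

instance (E : Type u) [SmallCategory E] [Preadditive E] [Linear k E] :
    (isLinearFunctor k E).ι.PreservesEpimorphisms :=
  ObjectProperty.preservesEpimorphisms_ι_of_isNormalMonoCategory _

lemma Bimod.mono_iff {N N' : Bimod k C D} (f : N ⟶ N') :
    Mono f ↔ ∀ a b, Function.Injective (homAt f a b) := by
  refine ⟨fun _ a b => ?_, fun h => ⟨fun g g' hg => hom_ext fun a b n => h a b ?_⟩⟩
  · have : Mono f.hom := inferInstanceAs (Mono ((isLinearFunctor k _).ι.map f))
    exact (ModuleCat.mono_iff_injective _).1 (inferInstanceAs (Mono (f.hom.app ⟨a, op b⟩)))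
  · rw [← homAt_comp, hg, homAt_comp]

lemma Bimod.epi_iff {N N' : Bimod k C D} (f : N ⟶ N') :
    Epi f ↔ ∀ a b, Function.Surjective (homAt f a b) := by
  refine ⟨fun _ a b => ?_, fun h => ⟨fun g g' hg => hom_ext fun a b n => ?_⟩⟩
  · have : Epi f.hom := inferInstanceAs (Epi ((isLinearFunctor k _).ι.map f))
    exact (ModuleCat.epi_iff_surjective _).1 (inferInstanceAs (Epi (f.hom.app ⟨a, op b⟩)))
  · obtain ⟨n, rfl⟩ := h a b n
    rw [← homAt_comp, hg, homAt_comp]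

/-- Linear functors are closed under subobjects and quotients among all functors, so kernels and
cokernels of modules are those of the functor category, hence are computed objectwise. -/
instance (E : Type u) [SmallCategory E] [Preadditive E] [Linear k E] :
    (isLinearFunctor k E).ι.PreservesHomology where
  preservesKernels _ _ f := by
    have := (isLinearFunctor k E).preservesKernels_ι
    exact this f
  preservesCokernels _ _ f := by
    have := (isLinearFunctor k E).preservesCokernels_ι
    exact this f

variable (k C D) in
/-- Evaluation of bimodules at a pair of objects. -/
def Bimod.evalAt (a : C) (b : D) : Bimod k C D ⥤ ModuleCat.{u} k :=
  (isLinearFunctor k (TensorCat k C Dᵒᵖ)).ι ⋙ (evaluation _ _).obj ⟨a, op b⟩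

instance (a : C) (b : D) : (Bimod.evalAt k C D a b).PreservesZeroMorphisms :=
  inferInstanceAs ((isLinearFunctor k _).ι ⋙ (evaluation _ _).obj _).PreservesZeroMorphisms

instance (a : C) (b : D) : (Bimod.evalAt k C D a b).PreservesHomology :=
  have := (isLinearFunctor k (TensorCat k C Dᵒᵖ)).ι.preservesFiniteLimits_of_preservesHomology
  have := (isLinearFunctor k (TensorCat k C Dᵒᵖ)).ι.preservesFiniteColimits_of_preservesHomology
  have : Limits.PreservesFiniteLimits (Bimod.evalAt k C D a b) :=
    Limits.comp_preservesFiniteLimits _ _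
  have : Limits.PreservesFiniteColimits (Bimod.evalAt k C D a b) :=
    Limits.comp_preservesFiniteColimits _ _
  inferInstance

/-- Each evaluation preserves homology, and a bimodule whose components all vanish is zero. -/
lemma Bimod.exact_iff (S : ShortComplex (Bimod k C D)) :
    S.Exact ↔ ∀ a b, Function.Exact (homAt S.f a b) (homAt S.g a b) := by
  refine ⟨fun h a b => (ShortComplex.ShortExact.moduleCat_exact_iff_function_exact _).1
    (h.map (evalAt k C D a b)), fun h => ?_⟩
  rw [ShortComplex.exact_iff_isZero_homology, Limits.IsZero.iff_id_eq_zero]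
  refine hom_ext fun a b n => ?_
  have e := (ShortComplex.ShortExact.moduleCat_exact_iff_function_exact
    (S.map (evalAt k C D a b))).2 (h a b)
  rw [ShortComplex.exact_iff_isZero_homology] at e
  have := ModuleCat.subsingleton_of_isZero
    (e.of_iso (S.mapHomologyIso (evalAt k C D a b)).symm)
  exact this.elim _ _

lemma Bimod.shortExact_iff (S : ShortComplex (Bimod k C D)) :
    S.ShortExact ↔ ∀ a b, Function.Injective (homAt S.f a b) ∧
      Function.Exact (homAt S.f a b) (homAt S.g a b) ∧
      Function.Surjective (homAt S.g a b) :=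
  ⟨fun h a b => ⟨(mono_iff _).1 h.mono_f a b, (exact_iff _).1 h.exact a b,
    (epi_iff _).1 h.epi_g a b⟩, fun h =>
    { exact := (exact_iff _).2 fun a b => (h a b).2.1
      mono_f := (mono_iff _).2 fun a b => (h a b).1
      epi_g := (epi_iff _).2 fun a b => (h a b).2.2 }⟩

variable {C' D' : Type u} [SmallCategory C'] [Preadditive C'] [Linear k C']
  [SmallCategory D'] [Preadditive D'] [Linear k D']
  (F : C ⥤ C') [F.Additive] [F.Linear k] (G : D ⥤ D') [G.Additive] [G.Linear k]

/-- Restriction of bimodules along `F` and `G`, as a functor. -/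
def Bimod.resFunctor : Bimod k C' D' ⥤ Bimod k C D where
  obj N := N.res k F G
  map f := ObjectProperty.homMk (Functor.whiskerLeft (TensorCat.map k F G.op) f.hom)

instance : (Bimod.resFunctor (k := k) F G).PreservesZeroMorphisms where

lemma Bimod.shortExact_res {S : ShortComplex (Bimod k C' D')} (hS : S.ShortExact) :
    (S.map (resFunctor F G)).ShortExact :=
  (shortExact_iff _).2 fun a b => (shortExact_iff S).1 hS (F.obj a) (G.obj b)

lemma Bimod.res_lact' (N : Bimod k C' D') (a a' : C) (b : D) (g : a ⟶ a') :
    (N.res k F G).lact a a' b g = N.lact (F.obj a) (F.obj a') (G.obj b) (F.map g) := by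
  change (N.obj.map (tmulHom k _ _ (op (G.obj b)) (op (G.obj b)) (F.map g) (G.op.map (𝟙 _)))).hom = _
  rw [G.op.map_id]
  rfl

lemma Bimod.res_ract' (N : Bimod k C' D') (a : C) (b b' : D) (h : b' ⟶ b) :
    (N.res k F G).ract a b b' h = N.ract (F.obj a) (G.obj b) (G.obj b') (G.map h) := by
  change (N.obj.map (tmulHom k _ _ (op (G.obj b)) (op (G.obj b')) (F.map (𝟙 a)) (G.map h).op)).hom
    = _
  rw [F.map_id]
  rfl

end BimodExact

/-! ## Functoriality of Hochschild-Mitchell cochains in the coefficients -/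

section HochschildCoefficients

variable {k : Type u} [Field k] {C : Type u} [SmallCategory C] [Preadditive C] [Linear k C]

lemma Multi.post_id {F : C → ModuleCat.{u} k} (n : ℕ) : ∀ (x₀ : C) (φ : Multi F n x₀),
    Multi.post n x₀ (fun _ => LinearMap.id) φ = φ := by
  induction n with
  | zero => exact fun x₀ φ => rfl
  | succ n ih => exact fun x₀ φ => Multi.ext fun x₁ g => ih _ _

variable {N N' N'' : Bimod k C C}

/-- Composition of cochains with a family of linear maps between the coefficients. -/
def hmPost (n : ℕ) (η : ∀ x y, N.at x y →ₗ[k] N'.at x y) :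
    (∀ x₀ : C, Multi (N.at x₀) n x₀) →ₗ[k] (∀ x₀ : C, Multi (N'.at x₀) n x₀) :=
  LinearMap.pi fun x₀ => Multi.post n x₀ (η x₀) ∘ₗ LinearMap.proj x₀

lemma hmPost_hmPost (n : ℕ) (η : ∀ x y, N.at x y →ₗ[k] N'.at x y)
    (η' : ∀ x y, N'.at x y →ₗ[k] N''.at x y) (φ : ∀ x₀ : C, Multi (N.at x₀) n x₀) :
    hmPost n η' (hmPost n η φ) = hmPost n (fun x y => η' x y ∘ₗ η x y) φ :=
  funext fun _ => Multi.post_post _ _ _ _ _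

lemma hmPost_id (n : ℕ) (φ : ∀ x₀ : C, Multi (N.at x₀) n x₀) :
    hmPost (N' := N) n (fun _ _ => LinearMap.id) φ = φ :=
  funext fun _ => Multi.post_id _ _ _

lemma hmPost_add (n : ℕ) (η η' : ∀ x y, N.at x y →ₗ[k] N'.at x y)
    (φ : ∀ x₀ : C, Multi (N.at x₀) n x₀) :
    hmPost n (fun x y => η x y + η' x y) φ = hmPost n η φ + hmPost n η' φ :=
  funext fun x₀ => congr($((Multi.post n x₀).map_add (η x₀) (η' x₀)) (φ x₀))

lemma hmPost_zero (n : ℕ) (φ : ∀ x₀ : C, Multi (N.at x₀) n x₀) :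
    hmPost (N' := N') n (fun _ _ => 0) φ = 0 :=
  funext fun x₀ => congr($((Multi.post n x₀).map_zero) (φ x₀))

/-- Compatibility with the left action handles the term `g₁ · φ(g₂, …)`, compatibility with the
right action handles all the others. -/
lemma hmDiff_hmPost_homAt (f : N ⟶ N') (n : ℕ) (φ : ∀ x₀ : C, Multi (N.at x₀) n x₀) :
    hmDiff N' n (hmPost n (Bimod.homAt f) φ) = hmPost (n + 1) (Bimod.homAt f) (hmDiff N n φ) := by
  refine funext fun x₀ => Multi.ext fun x₁ g => ?_
  have h := Multi.diff_post (N.ract x₀) (N'.ract x₀) (Bimod.homAt f x₀)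
    (fun a b g v => (Bimod.homAt_ract f x₀ g v).symm) n x₀ (φ x₀)
  change Multi.post n x₁ _ (Multi.post n x₁ _ (φ x₁)) -
    Multi.diff (N'.ract x₀) n x₀ (Multi.post n x₀ _ (φ x₀)) x₁ g =
    Multi.post n x₁ _ (Multi.post n x₁ _ (φ x₁) - Multi.diff (N.ract x₀) n x₀ (φ x₀) x₁ g)
  rw [h, map_sub, Multi.post_post, Multi.post_post]
  exact congrArg₂ (fun a b : Multi (N'.at x₀) n x₁ => a - b)
    (congrArg (fun η => Multi.post n x₁ η (φ x₁))
      (funext fun c => LinearMap.ext fun v => (Bimod.homAt_lact f c g v).symm)) rfl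

end HochschildCoefficients

/-! ### Splitting of short exact sequences of vector spaces -/

section Splitting

variable {k : Type*} [Field k] {U V W : Type*} [AddCommGroup U] [AddCommGroup V] [AddCommGroup W]
  [Module k U] [Module k V] [Module k W]

/-- This is where `k` being a field makes relative cochains exact in the coefficients: the
splittings, chosen for each pair of objects separately, need not respect any action. -/
lemma exists_splitting_of_exact (f : U →ₗ[k] V) (g : V →ₗ[k] W) (hf : Function.Injective f)
    (hfg : Function.Exact f g) (hg : Function.Surjective g) :
    ∃ (r : V →ₗ[k] U) (s : W →ₗ[k] V), r ∘ₗ f = LinearMap.id ∧ g ∘ₗ s = LinearMap.id ∧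
      f ∘ₗ r + s ∘ₗ g = LinearMap.id := by
  obtain ⟨s, hs⟩ := g.exists_rightInverse_of_surjective (LinearMap.range_eq_top.2 hg)
  have hs' (w) : g (s w) = w := LinearMap.congr_fun hs w
  have hr (v : V) : (LinearMap.id - s ∘ₗ g : V →ₗ[k] V) v ∈ LinearMap.range f :=
    (hfg _).1 (by simp [hs'])
  let r : V →ₗ[k] U := (LinearEquiv.ofInjective f hf).symm.toLinearMap ∘ₗ
    LinearMap.codRestrict (LinearMap.range f) (LinearMap.id - s ∘ₗ g) hr
  have hfr (v : V) : f (r v) = v - s (g v) :=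
    congrArg Subtype.val ((LinearEquiv.ofInjective f hf).apply_symm_apply ⟨_, hr v⟩)
  refine ⟨r, s, LinearMap.ext fun u => hf ?_, hs, LinearMap.ext fun v => ?_⟩
  · simp [hfr, hfg.apply_apply_eq_zero]
  · simp [hfr]

end Splitting

/-! ### Additive functors and biproducts -/

section Biprod

variable {k : Type u} [Field k] {A : Type*} [Category* A] [Preadditive A]
  [Limits.HasBinaryBiproducts A] (Φ : A ⥤ ModuleCat.{u} k) [Φ.Additive]

/-- An additive functor to vector spaces sends biproducts to products. -/
def biprodEquivProd (X Y : A) : Φ.obj (X ⊞ Y) ≃ₗ[k] Φ.obj X × Φ.obj Y :=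
  LinearEquiv.ofBijective
    ((Φ.map Limits.biprod.fst).hom.prod (Φ.map Limits.biprod.snd).hom) (by
      have h₁ (x : Φ.obj X) : (Φ.map Limits.biprod.fst).hom
          ((Φ.map (Limits.biprod.inl : X ⟶ X ⊞ Y)).hom x) = x := by
        rw [← LinearMap.comp_apply, ← ModuleCat.hom_comp, ← Φ.map_comp]; simp
      have h₂ (x : Φ.obj X) : (Φ.map Limits.biprod.snd).hom
          ((Φ.map (Limits.biprod.inl : X ⟶ X ⊞ Y)).hom x) = 0 := by
        rw [← LinearMap.comp_apply, ← ModuleCat.hom_comp, ← Φ.map_comp]; simp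
      have h₃ (y : Φ.obj Y) : (Φ.map Limits.biprod.fst).hom
          ((Φ.map (Limits.biprod.inr : Y ⟶ X ⊞ Y)).hom y) = 0 := by
        rw [← LinearMap.comp_apply, ← ModuleCat.hom_comp, ← Φ.map_comp]; simp
      have h₄ (y : Φ.obj Y) : (Φ.map Limits.biprod.snd).hom
          ((Φ.map (Limits.biprod.inr : Y ⟶ X ⊞ Y)).hom y) = y := by
        rw [← LinearMap.comp_apply, ← ModuleCat.hom_comp, ← Φ.map_comp]; simp
      refine ⟨(injective_iff_map_eq_zero _).2 fun z hz => ?_, fun ⟨x, y⟩ =>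
        ⟨(Φ.map Limits.biprod.inl).hom x + (Φ.map Limits.biprod.inr).hom y, ?_⟩⟩
      · have e : z = (Φ.map (Limits.biprod.inl : X ⟶ X ⊞ Y)).hom
              ((Φ.map Limits.biprod.fst).hom z) +
            (Φ.map (Limits.biprod.inr : Y ⟶ X ⊞ Y)).hom ((Φ.map Limits.biprod.snd).hom z) := by
          have := congr((Φ.map $(Limits.biprod.total (X := X) (Y := Y))).hom z)
          rw [Φ.map_add, Φ.map_comp, Φ.map_comp, Φ.map_id] at this
          exact this.symm
        obtain ⟨hz₁, hz₂⟩ := Prod.ext_iff.1 hz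
        change (Φ.map Limits.biprod.fst).hom z = 0 at hz₁
        change (Φ.map Limits.biprod.snd).hom z = 0 at hz₂
        rw [e, hz₁, hz₂, map_zero, map_zero, add_zero]
      · simp [h₁, h₂, h₃, h₄])

end Biprod

/-! ## The relative Hochschild-Mitchell complex of a glued category -/

namespace Glue

variable {k : Type u} [Field k] {C₁ C₂ : Type u} [SmallCategory C₁] [Preadditive C₁] [Linear k C₁]
  [SmallCategory C₂] [Preadditive C₂] [Linear k C₂] {M : Bimod k C₁ C₂}

/-- Extension by zero of a family of multilinear functions from `C₁` to `C₁ ⊔_M C₂`. -/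
def extend₁ (F : Glue M → ModuleCat.{u} k) :
    ∀ (n : ℕ) (x₀ : C₁), Multi (fun x => F (inl x)) n x₀ →ₗ[k] Multi F n (inl x₀)
  | 0, _ => LinearMap.id
  | n + 1, _ => LinearMap.pi fun X => match X with
    | inl x₁ =>
      { toFun := fun φ => extend₁ F n x₁ ∘ₗ φ x₁
        map_add' := fun _ _ => LinearMap.ext fun _ => map_add (extend₁ F n x₁) _ _
        map_smul' := fun _ _ => LinearMap.ext fun _ => map_smul (extend₁ F n x₁) _ _ }
    | inr _ => 0

/-- Extension by zero of a family of multilinear functions from `C₂` to `C₁ ⊔_M C₂`. -/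
def extend₂ (F : Glue M → ModuleCat.{u} k) :
    ∀ (n : ℕ) (y₀ : C₂), Multi (fun y => F (inr y)) n y₀ →ₗ[k] Multi F n (inr y₀)
  | 0, _ => LinearMap.id
  | n + 1, _ => LinearMap.pi fun X => match X with
    | inl _ => 0
    | inr y₁ =>
      { toFun := fun φ => extend₂ F n y₁ ∘ₗ φ y₁
        map_add' := fun _ _ => LinearMap.ext fun _ => map_add (extend₂ F n y₁) _ _
        map_smul' := fun _ _ => LinearMap.ext fun _ => map_smul (extend₂ F n y₁) _ _ }

lemma restrict_extend₁ (F : Glue M → ModuleCat.{u} k) (n : ℕ) :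
    ∀ (x₀ : C₁) (φ : Multi (fun x => F (inl x)) n x₀),
      Multi.restrict (incl₁ M) F n x₀ (extend₁ F n x₀ φ) = φ := by
  induction n with
  | zero => exact fun _ _ => rfl
  | succ n ih => exact fun x₀ φ => Multi.ext fun x₁ g => ih x₁ (φ x₁ g)

lemma restrict_extend₂ (F : Glue M → ModuleCat.{u} k) (n : ℕ) :
    ∀ (y₀ : C₂) (φ : Multi (fun y => F (inr y)) n y₀),
      Multi.restrict (incl₂ M) F n y₀ (extend₂ F n y₀ φ) = φ := by
  induction n with
  | zero => exact fun _ _ => rfl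
  | succ n ih => exact fun y₀ φ => Multi.ext fun y₁ g => ih y₁ (φ y₁ g)

variable (N : Bimod k (Glue M) (Glue M))

/-- Restriction of cochains to `C₁` and to `C₂`. -/
def restrictPair (n : ℕ) : (∀ X : Glue M, Multi (N.at X) n X) →ₗ[k]
    (∀ x : C₁, Multi ((r₁ N).at x) n x) × (∀ y : C₂, Multi ((r₂ N).at y) n y) :=
  (hmRestrictLinear (incl₁ M) N n).prod (hmRestrictLinear (incl₂ M) N n)

/-- Extension by zero gives a section in each degree. It is not asked to commute with differentials,
since surjectivity of a map of complexes is a degreewise condition. -/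
lemma restrictPair_surjective (n : ℕ) : Function.Surjective (restrictPair N n) := fun φ =>
  ⟨fun X => match X with
    | inl x => extend₁ (N.at (inl x)) n x (φ.1 x)
    | inr y => extend₂ (N.at (inr y)) n y (φ.2 y),
    Prod.ext (funext fun x => restrict_extend₁ (N.at (inl x)) n x (φ.1 x))
      (funext fun y => restrict_extend₂ (N.at (inr y)) n y (φ.2 y))⟩

/-- The cochains of `C₁ ⊔_M C₂` whose restrictions to `C₁` and to `C₂` vanish. -/
def relCochain (n : ℕ) : Submodule k (∀ X : Glue M, Multi (N.at X) n X) :=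
  LinearMap.ker (restrictPair N n)

lemma mem_relCochain_iff {n : ℕ} {φ : ∀ X : Glue M, Multi (N.at X) n X} :
    φ ∈ relCochain N n ↔
      hmRestrictLinear (incl₁ M) N n φ = 0 ∧ hmRestrictLinear (incl₂ M) N n φ = 0 :=
  LinearMap.mem_ker.trans Prod.ext_iff

lemma hmDiff_mem_relCochain {n : ℕ} {φ : ∀ X : Glue M, Multi (N.at X) n X}
    (hφ : φ ∈ relCochain N n) : hmDiff N n φ ∈ relCochain N (n + 1) := by
  rw [mem_relCochain_iff] at hφ ⊢
  rw [← hmDiff_hmRestrictLinear, ← hmDiff_hmRestrictLinear, hφ.1, hφ.2, map_zero, map_zero]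
  exact ⟨rfl, rfl⟩

-- Restriction only changes the arguments of a cochain, so it commutes with any linear maps on the
-- values. No compatibility of `η` with the actions is required, which allows `η` to be a vector
-- space splitting.
variable {N} in
lemma hmPost_mem_relCochain {N' : Bimod k (Glue M) (Glue M)} {n : ℕ}
    (η : ∀ X Y, N.at X Y →ₗ[k] N'.at X Y)
    {φ : ∀ X : Glue M, Multi (N.at X) n X} (hφ : φ ∈ relCochain N n) :
    hmPost n η φ ∈ relCochain N' n := by
  rw [mem_relCochain_iff] at hφ ⊢
  refine ⟨funext fun x => ?_, funext fun y => ?_⟩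
  · exact (Multi.post_restrict (incl₁ M) (η (inl x)) n x (φ (inl x))).symm.trans
      ((congrArg _ (congrFun hφ.1 x)).trans (map_zero _))
  · exact (Multi.post_restrict (incl₂ M) (η (inr y)) n y (φ (inr y))).symm.trans
      ((congrArg _ (congrFun hφ.2 y)).trans (map_zero _))

/-- The complex of cochains of `C₁ ⊔_M C₂` relative to `C₁` and `C₂`. -/
def relComplex : CochainComplex (ModuleCat.{u} k) ℕ :=
  CochainComplex.of (fun n => ModuleCat.of k (relCochain N n))
    (fun n => ModuleCat.ofHom ((hmDiff N n).restrict fun _ => hmDiff_mem_relCochain N))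
    (fun n => by ext φ : 2; exact Subtype.ext (hmDiff_hmDiff N n φ.1))

lemma relComplex_d (n : ℕ) : (relComplex N).d n (n + 1) =
    ModuleCat.ofHom ((hmDiff N n).restrict fun _ => hmDiff_mem_relCochain N) := by
  simp [relComplex, CochainComplex.of]

/-- The inclusion of relative cochains. -/
def relInclusion : relComplex N ⟶ hmComplex N :=
  CochainComplex.ofHom (fun n => ModuleCat.ofHom (relCochain N n).subtype)
    (fun n => by rw [relComplex_d, hmComplex_d]; rfl)

/-- Restriction of cochains to `C₁` and to `C₂`, as a morphism of complexes. -/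
def toBoundary : hmComplex N ⟶ hmComplex (r₁ N) ⊞ hmComplex (r₂ N) :=
  Limits.biprod.lift (hmRestrict (incl₁ M) N) (hmRestrict (incl₂ M) N)

lemma biprodEquivProd_toBoundary (n : ℕ) (φ : (hmComplex N).X n) :
    biprodEquivProd (HomologicalComplex.eval (ModuleCat.{u} k) _ n) _ _
      (((toBoundary N).f n).hom φ) = restrictPair N n φ := by
  refine Prod.ext ?_ ?_
  · change (((toBoundary N).f n) ≫ (Limits.biprod.fst :
      hmComplex (r₁ N) ⊞ hmComplex (r₂ N) ⟶ _).f n).hom φ = _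
    rw [← HomologicalComplex.comp_f, toBoundary, Limits.biprod.lift_fst]
    rfl
  · change (((toBoundary N).f n) ≫ (Limits.biprod.snd :
      hmComplex (r₁ N) ⊞ hmComplex (r₂ N) ⟶ _).f n).hom φ = _
    rw [← HomologicalComplex.comp_f, toBoundary, Limits.biprod.lift_snd]
    rfl

lemma toBoundary_f_eq_zero_iff (n : ℕ) (φ : (hmComplex N).X n) :
    ((toBoundary N).f n).hom φ = 0 ↔ restrictPair N n φ = 0 := by
  rw [← biprodEquivProd_toBoundary]
  exact (LinearEquiv.map_eq_zero_iff _).symm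

/-- The sequence of complexes formed by the relative cochains, all cochains, and the cochains
of `C₁` and `C₂`. -/
def boundarySequence : ShortComplex (CochainComplex (ModuleCat.{u} k) ℕ) :=
  ShortComplex.mk (relInclusion N) (toBoundary N) (by
    refine HomologicalComplex.hom_ext _ _ fun n => ModuleCat.hom_ext (LinearMap.ext fun φ => ?_)
    exact (toBoundary_f_eq_zero_iff N n φ.1).2 φ.2)

lemma boundarySequence_shortExact : (boundarySequence N).ShortExact := by
  refine HomologicalComplex.shortExact_of_degreewise_shortExact _ fun n => ?_
  refine ModuleCat.shortComplex_shortExact _ (fun φ => ?_) Subtype.val_injective fun z => ?_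
  · refine (toBoundary_f_eq_zero_iff N n φ).trans ⟨fun h => ⟨⟨φ, h⟩, rfl⟩, ?_⟩
    rintro ⟨ψ, rfl⟩
    exact ψ.2
  · obtain ⟨φ, hφ⟩ := restrictPair_surjective N n
      (biprodEquivProd (HomologicalComplex.eval (ModuleCat.{u} k) _ n) _ _ z)
    exact ⟨φ, (LinearEquiv.injective _) ((biprodEquivProd_toBoundary N n φ).trans hφ)⟩

variable {N} {N' N'' : Bimod k (Glue M) (Glue M)}

/-- The morphism of relative complexes induced by a morphism of coefficients. -/
def relMap (f : N ⟶ N') : relComplex N ⟶ relComplex N' :=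
  CochainComplex.ofHom
    (fun n => ModuleCat.ofHom ((hmPost n (Bimod.homAt f)).restrict
      fun _ => hmPost_mem_relCochain (Bimod.homAt f)))
    (fun n => by
      rw [relComplex_d, relComplex_d]
      ext φ : 2
      exact Subtype.ext (hmDiff_hmPost_homAt f n φ.1))

lemma relMap_comp_eq_zero (f : N ⟶ N') (g : N' ⟶ N'') (h : f ≫ g = 0) :
    relMap f ≫ relMap g = 0 := by
  refine HomologicalComplex.hom_ext _ _ fun n => ModuleCat.hom_ext (LinearMap.ext fun φ => ?_)
  refine Subtype.ext ((hmPost_hmPost n (Bimod.homAt f) (Bimod.homAt g) φ.1).trans ?_)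
  have e : (fun x y => Bimod.homAt g x y ∘ₗ Bimod.homAt f x y) = fun _ _ => 0 :=
    funext fun x => funext fun y => LinearMap.ext fun v => by
      change Bimod.homAt (f ≫ g) x y v = 0
      rw [h]
      rfl
  rw [e, hmPost_zero]
  rfl

/-- The sequence of relative complexes given by a sequence of coefficients. -/
def relSequence (S : ShortComplex (Bimod k (Glue M) (Glue M))) :
    ShortComplex (CochainComplex (ModuleCat.{u} k) ℕ) :=
  ShortComplex.mk (relMap S.f) (relMap S.g) (relMap_comp_eq_zero _ _ S.zero)

/-- Exactness is degreewise, and in each degree it is witnessed by composing cochains with the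
objectwise splittings `r` and `s`; these are not bimodule maps and induce no maps of complexes. -/
lemma relSequence_shortExact {S : ShortComplex (Bimod k (Glue M) (Glue M))} (hS : S.ShortExact) :
    (relSequence S).ShortExact := by
  have hS' := (Bimod.shortExact_iff S).1 hS
  choose r s hr hs hrs using fun x y => exists_splitting_of_exact _ _
    (hS' x y).1 (hS' x y).2.1 (hS' x y).2.2
  refine HomologicalComplex.shortExact_of_degreewise_shortExact _ fun n => ?_
  refine ModuleCat.shortComplex_shortExact _ (fun φ => ⟨fun h => ?_, ?_⟩) (fun φ ψ h => ?_)
    fun φ => ?_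
  · refine ⟨⟨hmPost n r φ.1, hmPost_mem_relCochain r φ.2⟩, Subtype.ext ?_⟩
    have h' : hmPost n (Bimod.homAt S.g) φ.1 = 0 := congrArg Subtype.val h
    change hmPost n (Bimod.homAt S.f) (hmPost n r φ.1) = φ.1
    -- From `f r + s g = 1` and `g φ = 0` it follows that `φ = f (r φ)`; the added zero is written
    -- as `s (g φ)`.
    rw [hmPost_hmPost, ← add_zero (hmPost n _ φ.1), ← map_zero (hmPost n s), ← h', hmPost_hmPost,
      ← hmPost_add, funext fun x => funext fun y => hrs x y, hmPost_id]
  · rintro ⟨ψ, rfl⟩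
    exact congr(($((relSequence S).zero).f n).hom ψ)
  · have h' : hmPost n (Bimod.homAt S.f) φ.1 = hmPost n (Bimod.homAt S.f) ψ.1 :=
      congrArg Subtype.val h
    have h'' := congrArg (hmPost n r) h'
    rw [hmPost_hmPost, hmPost_hmPost, funext fun x => funext fun y => hr x y, hmPost_id,
      hmPost_id] at h''
    exact Subtype.ext h''
  · refine ⟨⟨hmPost n s φ.1, hmPost_mem_relCochain s φ.2⟩, Subtype.ext ?_⟩
    change hmPost n (Bimod.homAt S.g) (hmPost n s φ.1) = φ.1
    rw [hmPost_hmPost, funext fun x => funext fun y => hs x y, hmPost_id]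

end Glue

/-! ## Contractions of Hochschild-Mitchell complexes with coinduced coefficients -/

section Contraction

variable {k : Type u} [Field k] {C : Type u} [SmallCategory C] [Preadditive C] [Linear k C]

lemma hmCohomology_isZero (N : Bimod k C C) (n : ℕ)
    (h : ∀ φ, hmDiff N (n + 1) φ = 0 → ∃ ψ, hmDiff N n ψ = φ) :
    Limits.IsZero (hmCohomology N (n + 1)) := by
  rw [← HomologicalComplex.exactAt_iff_isZero_homology,
    HomologicalComplex.exactAt_iff' _ n (n + 1) (n + 2) (by simp) (by simp),
    ShortComplex.moduleCat_exact_iff]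
  intro φ hφ
  change ((hmComplex N).d (n + 1) (n + 2)).hom φ = 0 at hφ
  rw [hmComplex_d] at hφ
  obtain ⟨ψ, hψ⟩ := h φ hφ
  refine ⟨ψ, ?_⟩
  change ((hmComplex N).d n (n + 1)).hom ψ = φ
  rw [hmComplex_d]
  exact hψ

lemma Multi.post_symm_post {F F' : C → ModuleCat.{u} k} (e : ∀ x, F x ≃ₗ[k] F' x) (n : ℕ) (x : C)
    (φ : Multi F n x) : Multi.post n x (fun y => (e y).symm.toLinearMap)
      (Multi.post n x (fun y => (e y).toLinearMap) φ) = φ := by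
  rw [Multi.post_post]
  simp only [LinearEquiv.symm_comp]
  exact Multi.post_id _ _ _

lemma Multi.post_post_symm {F F' : C → ModuleCat.{u} k} (e : ∀ x, F x ≃ₗ[k] F' x) (n : ℕ) (x : C)
    (φ : Multi F' n x) : Multi.post n x (fun y => (e y).toLinearMap)
      (Multi.post n x (fun y => (e y).symm.toLinearMap) φ) = φ :=
  Multi.post_symm_post (fun x => (e x).symm) n x φ

section Assemble

variable {x₀ : C} (F : C → C → ModuleCat.{u} k)

/-- Families, linear in `f : x₀ ⟶ a`, of multilinear functions, as multilinear functions with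
values in families. -/
def Multi.assemble : ∀ (n : ℕ) (x : C), (∀ a, (x₀ ⟶ a) →ₗ[k] Multi (F a) n x) →ₗ[k]
    Multi (fun y => ModuleCat.of k (∀ a, (x₀ ⟶ a) →ₗ[k] F a y)) n x
  | 0, _ => LinearMap.id
  | n + 1, _ => LinearMap.pi fun x₁ =>
    { toFun := fun Φ => Multi.assemble n x₁ ∘ₗ
        LinearMap.pi fun a => (LinearMap.proj x₁ ∘ₗ Φ a).flip
      map_add' := fun Φ Ψ => LinearMap.ext fun g => map_add (Multi.assemble n x₁)
        (LinearMap.pi (fun a => (LinearMap.proj x₁ ∘ₗ Φ a).flip) g)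
        (LinearMap.pi (fun a => (LinearMap.proj x₁ ∘ₗ Ψ a).flip) g)
      map_smul' := fun r Φ => LinearMap.ext fun g => map_smul (Multi.assemble n x₁) r
        (LinearMap.pi (fun a => (LinearMap.proj x₁ ∘ₗ Φ a).flip) g) }

/-- Evaluation of a family at `f : x₀ ⟶ a`. -/
def familyEval {a : C} (f : x₀ ⟶ a) (y : C) :
    (∀ a, (x₀ ⟶ a) →ₗ[k] F a y) →ₗ[k] F a y :=
  LinearMap.applyₗ f ∘ₗ LinearMap.proj a

lemma Multi.post_familyEval_assemble {a : C} (f : x₀ ⟶ a) (n : ℕ) :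
    ∀ (x : C) (Φ : ∀ a, (x₀ ⟶ a) →ₗ[k] Multi (F a) n x),
      Multi.post (F := fun y => ModuleCat.of k (∀ a, (x₀ ⟶ a) →ₗ[k] F a y)) n x
        (familyEval F f) (Multi.assemble F n x Φ) = Φ a f := by
  induction n with
  | zero => exact fun _ _ => rfl
  | succ n ih =>
    exact fun _ Φ => Multi.ext fun x₁ g =>
      ih x₁ (LinearMap.pi (fun a => (LinearMap.proj x₁ ∘ₗ Φ a).flip) g)

/-- Allows identities between functions with coinduced values to be checked after evaluation at each
`f`, that is, after acting by `f` and applying `ev`. -/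
lemma Multi.ext_familyEval (n : ℕ) : ∀ (x : C)
    (φ ψ : Multi (fun y => ModuleCat.of k (∀ a, (x₀ ⟶ a) →ₗ[k] F a y)) n x),
    (∀ (a : C) (f : x₀ ⟶ a), Multi.post (F' := F a) n x (familyEval F f) φ =
      Multi.post (F' := F a) n x (familyEval F f) ψ) → φ = ψ := by
  induction n with
  | zero => exact fun x φ ψ h => funext fun a => LinearMap.ext fun f => h a f
  | succ n ih =>
    exact fun x φ ψ h => Multi.ext fun x₁ g => ih x₁ _ _ fun a f =>
      congr($(h a f) x₁ g)

end Assemble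

/-- The cohomology of a bimodule that is coinduced on the left vanishes in positive degrees. -/
lemma hmCohomology_isZero_of_left (N : Bimod k C C) (W : C → C → ModuleCat.{u} k)
    (ρ : ∀ a b b', (b' ⟶ b) →ₗ[k] W a b →ₗ[k] W a b') (ev : ∀ a b, N.at a b →ₗ[k] W a b)
    (hev : ∀ (a b b' : C) (h : b' ⟶ b) (v : N.at a b),
      ρ a b b' h (ev a b v) = ev a b' (N.ract a b b' h v))
    (θ : ∀ x y, N.at x y ≃ₗ[k] (∀ a, (x ⟶ a) →ₗ[k] W a y))
    (hθ : ∀ (x y : C) (v : N.at x y) (a : C) (f : x ⟶ a),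
      θ x y v a f = ev a y (N.lact x a y f v)) (n : ℕ) :
    Limits.IsZero (hmCohomology N (n + 1)) := by
  refine hmCohomology_isZero N n fun φ hφ => ?_
  let F' (x y : C) : ModuleCat.{u} k := ModuleCat.of k (∀ a, (x ⟶ a) →ₗ[k] W a y)
  let Θ (x : C) (n : ℕ) (z : C) : Multi (N.at x) n z →ₗ[k] Multi (F' x) n z :=
    Multi.post n z fun y => (θ x y).toLinearMap
  let evf {x a : C} (f : x ⟶ a) (y : C) : N.at x y →ₗ[k] W a y := ev a y ∘ₗ N.lact x a y f
  have hΘ (x : C) (n : ℕ) (z : C) (φ : Multi (N.at x) n z) (a : C) (f : x ⟶ a) :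
      Multi.post (F' := W a) n z (familyEval W f) (Θ x n z φ) =
        Multi.post n z (evf f) φ := by
    refine (Multi.post_post _ _ _ _ _).trans (congrArg (fun η => Multi.post n z η φ) ?_)
    exact funext fun y => LinearMap.ext fun v => hθ x y v a f
  have hinj (x : C) (n : ℕ) (z : C) (φ ψ : Multi (N.at x) n z)
      (h : ∀ (a : C) (f : x ⟶ a), Multi.post n z (evf f) φ = Multi.post n z (evf f) ψ) :
      φ = ψ := by
    have e : Θ x n z φ = Θ x n z ψ := Multi.ext_familyEval W n z _ _ fun a f => by
      rw [hΘ, hΘ, h]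
    have e' := congrArg (Multi.post (F' := N.at x) n z fun y => (θ x y).symm.toLinearMap) e
    exact (Multi.post_symm_post (F' := F' x) (θ x) n z φ).symm.trans
      (e'.trans (Multi.post_symm_post (F' := F' x) (θ x) n z ψ))
  -- The contracting homotopy inserts a new first argument: `ψ` is the cochain with `ev (f · ψ(g₁,
  -- …, gₙ)) = ev (φ(f, g₁, …, gₙ))` for every `f`, which exists and is unique because `θ` is
  -- bijective.
  let ψ : ∀ x : C, Multi (N.at x) n x := fun x =>
    Multi.post (F := F' x) n x
      (fun y => (θ x y).symm.toLinearMap)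
      (Multi.assemble W n x fun a => Multi.post n x (ev a) ∘ₗ φ a x)
  have hψ (x a : C) (f : x ⟶ a) :
      Multi.post n x (evf f) (ψ x) = Multi.post n x (ev a) (φ a x f) := by
    rw [← hΘ]
    exact (congrArg _ (Multi.post_post_symm (F' := F' x) (θ x) n x _)).trans
      (Multi.post_familyEval_assemble W f n x _)
  -- It suffices to compare `ev (f · dψ(g, …))` with `ev (f · φ(g, …))`; the former is expressed
  -- through `φ(f g, …)` and the right-hand differential of `φ(f, …)`.
  refine ⟨ψ, funext fun x₀ => Multi.ext fun x₁ g => hinj x₀ n x₁ _ _ fun a f => ?_⟩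
  have h₁ : Multi.post n x₁ (evf f) (Multi.post n x₁ (fun c => N.lact x₁ x₀ c g) (ψ x₁)) =
      Multi.post n x₁ (ev a) (φ a x₁ (g ≫ f)) := by
    rw [Multi.post_post, ← hψ]
    refine congrArg (fun η => Multi.post n x₁ η (ψ x₁)) (funext fun y => LinearMap.ext fun v => ?_)
    exact congrArg (ev a y) (N.lact_lact y g f v)
  have h₂ : Multi.diff (ρ a) n x₀ (Multi.post n x₀ (evf f) (ψ x₀)) =
      Multi.post (n + 1) x₀ (evf f) (Multi.diff (N.ract x₀) n x₀ (ψ x₀)) :=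
    Multi.diff_post (N.ract x₀) (ρ a) (evf f) (fun b b' h v => (hev _ _ _ h _).trans
      (congrArg (ev a b') (N.lact_ract f h v).symm)) n x₀ _
  have h₃ : Multi.diff (ρ a) n x₀ (Multi.post n x₀ (ev a) (φ a x₀ f)) =
      Multi.post (n + 1) x₀ (ev a) (Multi.diff (N.ract a) n x₀ (φ a x₀ f)) :=
    Multi.diff_post _ _ _ (fun b b' h v => hev _ _ _ h v) n x₀ _
  rw [hψ, h₃] at h₂
  -- The cocycle identity of `φ` on `(f, g, …)`, solved for the term `f · φ(g, …)`.
  have h₄ : Multi.post n x₁ (fun c => N.lact x₀ a c f) (φ x₀ x₁ g) =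
      φ a x₁ (g ≫ f) - Multi.diff (N.ract a) n x₀ (φ a x₀ f) x₁ g := by
    have e : hmDiff N (n + 1) φ a x₀ f = 0 := congr($hφ a x₀ f)
    rw [hmDiff_apply, Multi.diff_succ, sub_eq_zero] at e
    exact congr($e x₁ g)
  have h₅ : Multi.post n x₁ (evf f) (φ x₀ x₁ g) =
      Multi.post n x₁ (ev a) (Multi.post n x₁ (fun c => N.lact x₀ a c f) (φ x₀ x₁ g)) :=
    (Multi.post_post _ _ _ _ _).symm
  rw [hmDiff_apply, map_sub, h₁, h₅, h₄, map_sub]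
  exact congrArg (fun b : Multi (W a) n x₁ => _ - b) congr($h₂ x₁ g).symm

/-- A multilinear function, regarded as a multilinear function of all but its last argument. -/
def Multi.last (F : C → ModuleCat.{u} k) : ∀ (n : ℕ) (x : C),
    Multi F (n + 1) x →ₗ[k] Multi (Multi F 1) n x
  | 0, _ => LinearMap.id
  | n + 1, _ => LinearMap.pi fun x₁ =>
    { toFun := fun φ => Multi.last F n x₁ ∘ₗ φ x₁
      map_add' := fun _ _ => LinearMap.ext fun _ => map_add (Multi.last F n x₁) _ _
      map_smul' := fun _ _ => LinearMap.ext fun _ => map_smul (Multi.last F n x₁) _ _ }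

lemma Multi.last_succ (F : C → ModuleCat.{u} k) (n : ℕ) (x : C) (φ : Multi F (n + 2) x) (x₁ : C)
    (g : x₁ ⟶ x) : Multi.last F (n + 1) x φ x₁ g = Multi.last F n x₁ (φ x₁ g) := rfl

lemma Multi.last_post {F F' : C → ModuleCat.{u} k} (η : ∀ x, F x →ₗ[k] F' x) (n : ℕ) :
    ∀ (x : C) (φ : Multi F (n + 1) x), Multi.last F' n x (Multi.post (n + 1) x η φ) =
      Multi.post n x (fun y => Multi.post 1 y η) (Multi.last F n x φ) := by
  induction n with
  | zero => exact fun _ _ => rfl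
  | succ n ih => exact fun x φ => Multi.ext fun x₁ g => ih x₁ _

/-- Suppose `ev (ψ(g₁, …, gₙ) · e) = ev (φ(g₁, …, gₙ, e))`. Then `D ψ` evaluated at `e` and `D φ`
with last argument `e` have the same terms: the right action of `gₙ₊₁` on `ψ` becomes the merged
argument `gₙ₊₁ e` in `φ`. Only the final term of `D φ`, the action of `e` on `φ(g₁, …, gₙ₊₁)` with
sign `(-1)ⁿ⁺¹`, has no counterpart, and the added summand cancels it. -/
lemma Multi.post_diff_of_last {F W : C → ModuleCat.{u} k}
    (ρ : ∀ a b, (b ⟶ a) →ₗ[k] F a →ₗ[k] F b)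
    (hρ : ∀ (a b c) (g : b ⟶ a) (h : c ⟶ b) (v), ρ b c h (ρ a b g v) = ρ a c (h ≫ g) v)
    (ev : ∀ x, F x →ₗ[k] W x) (θ : ∀ x, F x →ₗ[k] Multi W 1 x)
    (hθ : ∀ (x : C) (v : F x) (b : C) (e : b ⟶ x), θ x v b e = ev b (ρ x b e v)) (n : ℕ) :
    ∀ (x : C) (φ : Multi F (n + 1) x) (ψ : Multi F n x),
      Multi.post n x θ ψ = Multi.last W n x (Multi.post (n + 1) x ev φ) →
      Multi.post (n + 1) x θ (Multi.diff ρ n x ψ) =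
        Multi.last W (n + 1) x (Multi.post (n + 2) x ev (Multi.diff ρ (n + 1) x φ)) +
          (-1 : k) ^ n • Multi.post (n + 1) x θ φ := by
  induction n with
  | zero =>
    intro x φ ψ h
    refine Multi.ext fun x₁ g => Multi.ext fun x₂ e => ?_
    have h' : ev x₂ (ρ x x₂ (e ≫ g) ψ) = ev x₂ (φ x₂ (e ≫ g)) :=
      (hθ x ψ x₂ (e ≫ g)).symm.trans congr($h x₂ (e ≫ g))
    change θ x₁ (ρ x x₁ g ψ) x₂ e =
      ev x₂ (φ x₂ (e ≫ g) - ρ x₁ x₂ e (φ x₁ g)) + (-1 : k) ^ 0 • θ x₁ (φ x₁ g) x₂ e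
    rw [hθ, hθ, hρ, map_sub, h', pow_zero, one_smul, sub_add_cancel]
  | succ n ih =>
    intro x φ ψ h
    refine Multi.ext fun x₁ g => ?_
    have h₁ := ih x₁ (φ x₁ g) (ψ x₁ g) congr($h x₁ g)
    have h₂ : Multi.post (n + 1) x₁ θ (Multi.comp n x x₁ g ψ) =
        Multi.last W (n + 1) x₁ (Multi.post (n + 2) x₁ ev (Multi.comp (n + 1) x x₁ g φ)) :=
      Multi.ext fun x₂ e => congr($h x₂ (e ≫ g))
    rw [Multi.post_succ, Multi.diff_succ, Multi.add_apply, Multi.last_succ, Multi.post_succ,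
      Multi.diff_succ, map_sub, map_sub, map_sub, h₁, h₂, Multi.smul_apply, Multi.post_succ,
      pow_succ, mul_neg_one, neg_smul]
    abel

/-- The cohomology of a bimodule that is coinduced on the right vanishes in positive degrees. -/
lemma hmCohomology_isZero_of_right (N : Bimod k C C) (W : C → C → ModuleCat.{u} k)
    (l : ∀ a a' b, (a ⟶ a') →ₗ[k] W a b →ₗ[k] W a' b) (ev : ∀ a b, N.at a b →ₗ[k] W a b)
    (hev : ∀ (a a' b : C) (g : a ⟶ a') (v : N.at a b),
      l a a' b g (ev a b v) = ev a' b (N.lact a a' b g v))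
    (θ : ∀ x y, N.at x y ≃ₗ[k] (∀ b, (b ⟶ y) →ₗ[k] W x b))
    (hθ : ∀ (x y : C) (v : N.at x y) (b : C) (e : b ⟶ y),
      θ x y v b e = ev x b (N.ract x y b e v)) (n : ℕ) :
    Limits.IsZero (hmCohomology N (n + 1)) := by
  refine hmCohomology_isZero N n fun φ hφ => ?_
  let Θ (x : C) (n : ℕ) (z : C) : Multi (N.at x) n z →ₗ[k] Multi (Multi (W x) 1) n z :=
    Multi.post n z fun y => (θ x y).toLinearMap
  have hΘ (x : C) (n : ℕ) (z : C) (φ : Multi (N.at x) n z) :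
      Multi.post (F := Multi (W x) 1) n z (fun y => (θ x y).symm.toLinearMap) (Θ x n z φ) = φ :=
    Multi.post_symm_post (F' := Multi (W x) 1) (θ x) n z φ
  -- Here the homotopy inserts a new last argument: `ev (ψ(g₁, …, gₙ) · e) = ev (φ(g₁, …, gₙ, e))`.
  let ψ : ∀ x : C, Multi (N.at x) n x := fun x =>
    Multi.post (F := Multi (W x) 1) n x (fun y => (θ x y).symm.toLinearMap)
      (Multi.last (W x) n x (Multi.post (n + 1) x (ev x) (φ x)))
  have hψ (x : C) : Θ x n x (ψ x) =
      Multi.last (W x) n x (Multi.post (n + 1) x (ev x) (φ x)) :=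
    Multi.post_post_symm (F' := Multi (W x) 1) (θ x) n x _
  -- The cocycle condition gives `dψ = (-1)ⁿ⁺¹ φ`, the sign coming from the last argument standing
  -- at position `n + 1`; the scalar is its own inverse.
  refine ⟨(-1 : k) ^ (n + 1) • ψ, funext fun x₀ => Multi.ext fun x₁ g => ?_⟩
  have h₁ : Θ x₀ n x₁ (Multi.post n x₁ (fun c => N.lact x₁ x₀ c g) (ψ x₁)) =
      Multi.last (W x₀) n x₁ (Multi.post (n + 1) x₁ (ev x₀)
        (Multi.post (n + 1) x₁ (fun c => N.lact x₁ x₀ c g) (φ x₁))) := by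
    have e : Multi.post (n + 1) x₁ (ev x₀)
        (Multi.post (n + 1) x₁ (fun c => N.lact x₁ x₀ c g) (φ x₁)) =
        Multi.post (n + 1) x₁ (fun c => l x₁ x₀ c g) (Multi.post (n + 1) x₁ (ev x₁) (φ x₁)) := by
      rw [Multi.post_post, Multi.post_post]
      exact congrArg (fun η => Multi.post (n + 1) x₁ η (φ x₁))
        (funext fun c => LinearMap.ext fun v => (hev _ _ c g v).symm)
    rw [e, Multi.last_post, ← hψ]
    refine (Multi.post_post _ _ _ _ _).trans (Eq.trans ?_ (Multi.post_post _ _ _ _ _).symm)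
    refine congrArg (fun η => Multi.post (F' := Multi (W x₀) 1) n x₁ η (ψ x₁))
      (funext fun c => LinearMap.ext fun v => Multi.ext fun b e => ?_)
    refine (hθ _ _ _ _ _).trans ?_
    change _ = l x₁ x₀ b g (θ x₁ c v b e)
    rw [hθ, hev, N.lact_ract]
  have h₂ := Multi.post_diff_of_last (N.ract x₀) (fun a b c g h v => N.ract_ract x₀ h g v) (ev x₀)
    (fun y => (θ x₀ y).toLinearMap) (fun y v b e => hθ x₀ y v b e) n x₀ (φ x₀) (ψ x₀) (hψ x₀)
  have h₃ : Θ x₀ n x₁ (hmDiff N n ψ x₀ x₁ g) = (-1 : k) ^ (n + 1) • Θ x₀ n x₁ (φ x₀ x₁ g) := by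
    have e : Multi.post (n + 1) x₁ (fun c => N.lact x₁ x₀ c g) (φ x₁) =
        Multi.diff (N.ract x₀) (n + 1) x₀ (φ x₀) x₁ g := by
      rw [← sub_eq_zero, ← hmDiff_apply, hφ]
      rfl
    rw [hmDiff_apply, map_sub, h₁, e]
    refine (congrArg (fun b : Multi (Multi (W x₀) 1) n x₁ => _ - b) congr($h₂ x₁ g)).trans ?_
    rw [Multi.add_apply, Multi.last_succ, Multi.smul_apply, pow_succ, mul_neg_one, neg_smul]
    exact sub_add_cancel_left _ _
  have h₄ : hmDiff N n ψ x₀ x₁ g = (-1 : k) ^ (n + 1) • φ x₀ x₁ g := by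
    rw [← hΘ x₀ n x₁ (hmDiff N n ψ x₀ x₁ g), h₃, map_smul, hΘ]
  rw [map_smul]
  change (-1 : k) ^ (n + 1) • hmDiff N n ψ x₀ x₁ g = _
  rw [h₄, smul_smul, ← mul_pow, neg_one_mul, neg_neg, one_pow, one_smul]

end Contraction

/-! ## Coinduced bimodules -/

section Coinduced

variable {k : Type u} [Field k] {C : Type u} [SmallCategory C] [Preadditive C] [Linear k C]
  {D : Type u} [SmallCategory D] [Preadditive D] [Linear k D]

/-- The two-sided action `n ↦ f · n · e` of a bimodule. -/
def Bimod.biact (N : Bimod k C D) (x a : C) (y b : D) :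
    N.at x y →ₗ[k] (x ⟶ a) →ₗ[k] (b ⟶ y) →ₗ[k] N.at a b :=
  LinearMap.mk₂ k (fun n f => N.lact x a b f ∘ₗ (N.ract x y b).flip n)
    (fun n n' f => by rw [map_add, LinearMap.comp_add])
    (fun c n f => by rw [map_smul, LinearMap.comp_smul])
    (fun n f f' => by rw [map_add, LinearMap.add_comp])
    (fun c n f => by rw [map_smul, LinearMap.smul_comp])

/-- The right action on families of linear functions of morphisms to a given object. -/
def familyRight (F : D → ModuleCat.{u} k) (y y' : D) :
    (y' ⟶ y) →ₗ[k] (∀ b, (b ⟶ y) →ₗ[k] F b) →ₗ[k] (∀ b, (b ⟶ y') →ₗ[k] F b) :=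
  LinearMap.mk₂ k (fun h Φ b => Φ b ∘ₗ Linear.rightComp k b h)
    (fun h h' Φ => funext fun b => LinearMap.ext fun e => by simp)
    (fun c h Φ => funext fun b => LinearMap.ext fun e => by simp)
    (fun _ _ _ => rfl) (fun _ _ _ => rfl)

/-- The left action on families of linear functions of morphisms from a given object. -/
def familyLeft (F : C → ModuleCat.{u} k) (x x' : C) :
    (x ⟶ x') →ₗ[k] (∀ a, (x ⟶ a) →ₗ[k] F a) →ₗ[k] (∀ a, (x' ⟶ a) →ₗ[k] F a) :=
  LinearMap.mk₂ k (fun g Φ a => Φ a ∘ₗ Linear.leftComp k a g)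
    (fun g g' Φ => funext fun a => LinearMap.ext fun f => by simp)
    (fun c g Φ => funext fun a => LinearMap.ext fun f => by simp)
    (fun _ _ _ => rfl) (fun _ _ _ => rfl)

/-- The components of the coinduced bimodule. -/
@[reducible] def CoindAt (V : C → D → ModuleCat.{u} k) (x : C) (y : D) : ModuleCat.{u} k :=
  ModuleCat.of k (∀ a, (x ⟶ a) →ₗ[k] ∀ b, (b ⟶ y) →ₗ[k] V a b)

lemma CoindAt.ext {V : C → D → ModuleCat.{u} k} {x : C} {y : D} {Φ Ψ : CoindAt V x y}
    (h : ∀ (a : C) (f : x ⟶ a) (b : D) (e : b ⟶ y), Φ a f b e = Ψ a f b e) : Φ = Ψ :=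
  funext fun a => LinearMap.ext fun f => funext fun b => LinearMap.ext fun e => h a f b e

variable (V : C → D → ModuleCat.{u} k)

/-- The left action on the coinduced bimodule. -/
def CoindAt.lact (x x' : C) (y : D) : (x ⟶ x') →ₗ[k] CoindAt V x y →ₗ[k] CoindAt V x' y :=
  familyLeft (fun a => ModuleCat.of k (∀ b, (b ⟶ y) →ₗ[k] V a b)) x x'

/-- The right action on the coinduced bimodule. -/
def CoindAt.ract (x : C) (y y' : D) : (y' ⟶ y) →ₗ[k] CoindAt V x y →ₗ[k] CoindAt V x y' :=
  LinearMap.mk₂ k (fun h Φ a => familyRight (V a) y y' h ∘ₗ Φ a)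
    (fun h h' Φ => funext fun a => by rw [map_add, LinearMap.add_comp]; rfl)
    (fun c h Φ => funext fun a => by rw [map_smul, LinearMap.smul_comp]; rfl)
    (fun _ _ _ => funext fun a => LinearMap.comp_add _ _ _)
    (fun _ _ _ => funext fun a => LinearMap.comp_smul _ _ _)

lemma CoindAt.lact_apply {x x' : C} {y : D} (g : x ⟶ x') (Φ : CoindAt V x y) (a : C)
    (f : x' ⟶ a) : CoindAt.lact V x x' y g Φ a f = Φ a (g ≫ f) := rfl

lemma CoindAt.ract_apply {x : C} {y y' : D} (h : y' ⟶ y) (Φ : CoindAt V x y) (a : C)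
    (f : x ⟶ a) (b : D) (e : b ⟶ y') : CoindAt.ract V x y y' h Φ a f b e = Φ a f b (e ≫ h) := rfl

lemma CoindAt.lact_id (x : C) (y : D) (Φ : CoindAt V x y) : CoindAt.lact V x x y (𝟙 x) Φ = Φ :=
  CoindAt.ext fun _ _ _ _ => by rw [CoindAt.lact_apply, Category.id_comp]

lemma CoindAt.ract_id (x : C) (y : D) (Φ : CoindAt V x y) : CoindAt.ract V x y y (𝟙 y) Φ = Φ :=
  CoindAt.ext fun _ _ _ _ => by rw [CoindAt.ract_apply, Category.comp_id]

lemma CoindAt.lact_lact {a₁ a₂ a₃ : C} (b : D) (g : a₁ ⟶ a₂) (g' : a₂ ⟶ a₃)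
    (Φ : CoindAt V a₁ b) : CoindAt.lact V _ _ b g' (CoindAt.lact V _ _ b g Φ) =
      CoindAt.lact V _ _ b (g ≫ g') Φ :=
  CoindAt.ext fun _ _ _ _ => by
    rw [CoindAt.lact_apply, CoindAt.lact_apply, CoindAt.lact_apply, Category.assoc]

lemma CoindAt.ract_ract (a : C) {b₁ b₂ b₃ : D} (h : b₁ ⟶ b₂) (h' : b₂ ⟶ b₃)
    (Φ : CoindAt V a b₃) : CoindAt.ract V a _ _ h (CoindAt.ract V a _ _ h' Φ) =
      CoindAt.ract V a _ _ (h ≫ h') Φ :=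
  CoindAt.ext fun _ _ _ _ => by
    rw [CoindAt.ract_apply, CoindAt.ract_apply, CoindAt.ract_apply, Category.assoc]

lemma CoindAt.lact_ract {a a' : C} {b b' : D} (g : a ⟶ a') (h : b' ⟶ b) (Φ : CoindAt V a b) :
    CoindAt.lact V _ _ _ g (CoindAt.ract V _ _ _ h Φ) =
      CoindAt.ract V _ _ _ h (CoindAt.lact V _ _ _ g Φ) := rfl

/-- The bimodule coinduced from a family of vector spaces. -/
def coind : Bimod k C D :=
  Bimod.ofActions (CoindAt V) (CoindAt.lact V) (CoindAt.ract V) (CoindAt.lact_id V)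
    (CoindAt.ract_id V) (CoindAt.lact_lact V) (CoindAt.ract_ract V) (CoindAt.lact_ract V)

lemma coind_lact (x x' : C) (y : D) (g : x ⟶ x') :
    (coind V).lact x x' y g = CoindAt.lact V x x' y g :=
  Bimod.ofActions_lact _ _ _ (CoindAt.lact_id V) (CoindAt.ract_id V) (CoindAt.lact_lact V)
    (CoindAt.ract_ract V) (CoindAt.lact_ract V) _ _ _ _

lemma coind_ract (x : C) (y y' : D) (h : y' ⟶ y) :
    (coind V).ract x y y' h = CoindAt.ract V x y y' h :=
  Bimod.ofActions_ract _ _ _ (CoindAt.lact_id V) (CoindAt.ract_id V) (CoindAt.lact_lact V)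
    (CoindAt.ract_ract V) (CoindAt.lact_ract V) _ _ _ _

/-- The embedding of a bimodule in the bimodule coinduced from its components. -/
def toCoind (N : Bimod k C D) : N ⟶ coind N.at :=
  Bimod.homMk (N := N) (N' := coind N.at)
    (fun x y => LinearMap.pi fun a =>
      { toFun := fun n => LinearMap.pi fun b => N.biact x a y b n
        map_add' := fun n n' => LinearMap.ext fun f => funext fun b =>
          congr($((N.biact x a y b).map_add n n') f)
        map_smul' := fun c n => LinearMap.ext fun f => funext fun b =>
          congr($((N.biact x a y b).map_smul c n) f) })
    (fun {x x'} y g n => by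
      rw [coind_lact]
      refine CoindAt.ext fun a f b e => ?_
      change N.lact _ _ _ f (N.ract _ _ _ e (N.lact _ _ _ g n)) =
        N.lact _ _ _ (g ≫ f) (N.ract _ _ _ e n)
      rw [← N.lact_ract, N.lact_lact])
    (fun x {y y'} h n => by
      rw [coind_ract]
      refine CoindAt.ext fun a f b e => ?_
      change N.lact _ _ _ f (N.ract _ _ _ e (N.ract _ _ _ h n)) =
        N.lact _ _ _ f (N.ract _ _ _ (e ≫ h) n)
      rw [N.ract_ract])

/-- An element `n` is recovered from its family `(f, e) ↦ f · n · e` at the identities. -/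
instance (N : Bimod k C D) : Mono (toCoind N) :=
  (Bimod.mono_iff _).2 fun x y n n' h => by
    have e : N.lact _ _ _ (𝟙 x) (N.ract _ _ _ (𝟙 y) n) =
      N.lact _ _ _ (𝟙 x) (N.ract _ _ _ (𝟙 y) n') := congr($h x (𝟙 x) y (𝟙 y))
    rwa [N.lact_id, N.lact_id, N.ract_id, N.ract_id] at e

/-- By its very form the coinduced bimodule is coinduced on the left, from `W a y = ∏_b Hom_k(C(b,
y), V a b)`, so `θ` is the identity and `ev` is evaluation at `𝟙 a`. -/
lemma hmCohomology_coind_isZero (V : C → C → ModuleCat.{u} k) (n : ℕ) :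
    Limits.IsZero (hmCohomology (coind V) (n + 1)) :=
  hmCohomology_isZero_of_left (coind V)
    (fun a y => ModuleCat.of k (∀ b, (b ⟶ y) →ₗ[k] V a b))
    (fun a b b' => familyRight (V a) b b')
    (fun a b => LinearMap.applyₗ (𝟙 a) ∘ₗ LinearMap.proj a)
    (fun a b b' h v => by rw [coind_ract]; rfl)
    (fun x y => LinearEquiv.refl k _)
    (fun x y v a f => by
      rw [coind_lact]
      exact congrArg (v a) (Category.comp_id f).symm)
    n

end Coinduced

/-! ### Restrictions of coinduced bimodules of the glued category -/

namespace Glue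

variable {k : Type u} [Field k] {C₁ C₂ : Type u} [SmallCategory C₁] [Preadditive C₁] [Linear k C₁]
  [SmallCategory C₂] [Preadditive C₂] [Linear k C₂] {M : Bimod k C₁ C₂}

/-- The triangular shape of the glued category. All vanishing and injectivity results for
restrictions of `coind V` rest on it. -/
instance (x : C₁) (y : C₂) : Subsingleton ((inl x : Glue M) ⟶ inr y) :=
  inferInstanceAs (Subsingleton PUnit)

variable (V : Glue M → Glue M → ModuleCat.{u} k)

/-- Morphisms out of `inl x` reach only objects of `C₁`, so the product over targets `A` collapses
to `C₁` and `r₁ (coind V)` is coinduced on the left over `C₁`. The left side is essential: morphisms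
into `inl y` may also start in `C₂`, through `M`. -/
lemma hmCohomology_r₁_coind_isZero (n : ℕ) :
    Limits.IsZero (hmCohomology (r₁ (coind V)) (n + 1)) := by
  refine hmCohomology_isZero_of_left (r₁ (coind V))
    (fun a y => ModuleCat.of k (∀ B : Glue M, (B ⟶ inl y) →ₗ[k] V (inl a) B))
    (fun a b b' => familyRight (V (inl a)) (inl b) (inl b') ∘ₗ (incl₁ M).mapLinearMap k)
    (fun a b => LinearMap.applyₗ (𝟙 (inl a : Glue M)) ∘ₗ
      LinearMap.proj (φ := fun A : Glue M => (inl a ⟶ A) →ₗ[k] ∀ B, (B ⟶ inl b) →ₗ[k] V A B) (inl a))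
    (fun a b b' h v => by rw [Bimod.res_ract, coind_ract]; rfl)
    (fun x y => LinearEquiv.ofBijective
      (LinearMap.pi fun a : C₁ => LinearMap.proj
        (φ := fun A : Glue M => (inl x ⟶ A) →ₗ[k] ∀ B, (B ⟶ inl y) →ₗ[k] V A B) (inl a))
      ⟨fun Φ Ψ h => ?_, fun Φ => ⟨fun A => match A with
        | inl a => Φ a
        | inr _ => 0, rfl⟩⟩)
    (fun x y v a f => by
      rw [Bimod.res_lact, coind_lact]
      exact congrArg (v (inl a)) (Category.comp_id ((incl₁ M).map f)).symm)
    n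
  refine funext fun A => match A with
    | inl a => congrFun h a
    | inr b => LinearMap.ext fun f => ?_
  rw [Subsingleton.elim f 0, map_zero, map_zero]

/-- Mirror image: morphisms into `inr y` come only from `C₂`, so `r₂ (coind V)` is coinduced on the
right, whereas morphisms out of `inr x` may end in `C₁`. -/
lemma hmCohomology_r₂_coind_isZero (n : ℕ) :
    Limits.IsZero (hmCohomology (r₂ (coind V)) (n + 1)) := by
  refine hmCohomology_isZero_of_right (r₂ (coind V))
    (fun x b => ModuleCat.of k (∀ A : Glue M, (inr x ⟶ A) →ₗ[k] V A (inr b)))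
    (fun a a' b => familyLeft (fun A => V A (inr b)) (inr a) (inr a') ∘ₗ
      (incl₂ M).mapLinearMap k)
    (fun x b =>
      { toFun := fun (Φ : CoindAt V (inr x) (inr b)) A =>
          (LinearMap.applyₗ (𝟙 (inr b : Glue M)) ∘ₗ LinearMap.proj (inr b)) ∘ₗ Φ A
        map_add' := fun _ _ => rfl
        map_smul' := fun _ _ => rfl })
    (fun a a' b g v => by rw [Bimod.res_lact, coind_lact]; rfl)
    (fun x y => LinearEquiv.ofBijective
      (LinearMap.pi fun b : C₂ =>
        { toFun := fun (Φ : CoindAt V (inr x) (inr y)) =>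
            LinearMap.pi fun A => (LinearMap.proj (inr b) ∘ₗ Φ A).flip
          map_add' := fun _ _ => rfl
          map_smul' := fun _ _ => rfl })
      ⟨fun Φ Ψ h => ?_, fun Φ => ⟨fun A => LinearMap.pi fun B => match B with
        | inl _ => 0
        | inr b => (LinearMap.proj A ∘ₗ Φ b).flip, rfl⟩⟩)
    (fun x y v b e => by
      rw [Bimod.res_ract, coind_ract]
      refine funext fun A => LinearMap.ext fun f => ?_
      exact congrArg (v A f (inr b)) (Category.id_comp ((incl₂ M).map e)).symm)
    n
  refine CoindAt.ext fun A f B e => ?_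
  cases B with
  | inl b => rw [Subsingleton.elim e 0, map_zero, map_zero]
  | inr b => exact congr($h b e A f)

/-- For `x` in `C₁` and `y` in `C₂` both products collapse: only targets in `C₁` and sources in `C₂`
contribute. Thus `r₁₂ (coind V)` is coinduced on both sides over `C₁` and `C₂`. -/
lemma coindAt_ext {x : C₁} {y : C₂} {Φ Ψ : CoindAt V (inl x) (inr y)}
    (h : ∀ (a : C₁) (f : (inl x : Glue M) ⟶ inl a) (b : C₂) (e : (inr b : Glue M) ⟶ inr y),
      Φ (inl a) f (inr b) e = Ψ (inl a) f (inr b) e) : Φ = Ψ := by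
  refine CoindAt.ext fun A f B e => ?_
  cases A with
  | inr a => rw [Subsingleton.elim f 0, map_zero, map_zero]
  | inl a =>
    cases B with
    | inl b => rw [Subsingleton.elim e 0, map_zero, map_zero]
    | inr b => exact h a f b e

/-- Bimodule maps `X ⟶ r₁₂ (coind V)` correspond to arbitrary families of linear maps `X(a, b) →
V(a, b)`, and linear maps extend along injections of vector spaces. -/
instance injective_r₁₂_coind : Injective (r₁₂ (coind V)) where
  factors {X Y} g i _ := by
    have hi := (Bimod.mono_iff i).1 inferInstance
    choose t ht using fun a b => (Bimod.homAt i a b).exists_leftInverse_of_injective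
      (LinearMap.ker_eq_bot.2 (hi a b))
    -- The family corresponding to `g`: evaluate at the two identities. The next identity recovers
    -- `g` from it as `g(v)(f, e) = p (f · v · e)`.
    let p (a : C₁) (b : C₂) : X.at a b →ₗ[k] V (inl a) (inr b) :=
      { toFun := fun v => (show CoindAt V (inl a) (inr b) from Bimod.homAt g a b v)
          (inl a) (𝟙 (inl a : Glue M)) (inr b) (𝟙 (inr b : Glue M))
        map_add' := fun v w => by rw [map_add]; rfl
        map_smul' := fun c v => by rw [map_smul]; rfl }
    have hg (x : C₁) (y : C₂) (v : X.at x y) (a : C₁) (f : x ⟶ a) (b : C₂) (e : b ⟶ y) :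
        (show CoindAt V (inl x) (inr y) from Bimod.homAt g x y v) (inl a) f (inr b) e =
          p a b (X.lact _ _ _ f (X.ract _ _ _ e v)) := by
      have h₁ : Bimod.homAt g a b (X.lact _ _ _ f (X.ract _ _ _ e v)) =
          CoindAt.lact V (inl x) (inl a) (inr b) f
            (CoindAt.ract V (inl x) (inr y) (inr b) e (Bimod.homAt g x y v)) := by
        rw [Bimod.homAt_lact, Bimod.homAt_ract, Bimod.res_lact', Bimod.res_ract', coind_lact,
          coind_ract]
        rfl
      have h₂ : p a b (X.lact _ _ _ f (X.ract _ _ _ e v)) =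
          (show CoindAt V (inl x) (inr y) from Bimod.homAt g x y v) (inl a)
            ((show (inl x : Glue M) ⟶ inl a from f) ≫ 𝟙 (inl a : Glue M)) (inr b)
            (𝟙 (inr b : Glue M) ≫ (show (inr b : Glue M) ⟶ inr y from e)) :=
        congr($h₁ (inl a) (𝟙 (inl a : Glue M)) (inr b) (𝟙 (inr b : Glue M)))
      rw [h₂, Category.comp_id, Category.id_comp]
    -- The extension corresponds to the family `p ∘ t`, with `t` a linear retraction of `i`:
    -- `G(w)(f, e) = p (t (f · w · e))`, and zero at the remaining pairs of objects, where it is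
    -- forced.
    let G (x : C₁) (y : C₂) : Y.at x y →ₗ[k] (r₁₂ (coind V)).at x y :=
      LinearMap.pi (φ := fun A : Glue M => (inl x ⟶ A) →ₗ[k] ∀ B, (B ⟶ inr y) →ₗ[k] V A B)
        fun A => match A with
        | inl a =>
          { toFun := fun w => LinearMap.pi fun B => match B with
              | inl _ => 0
              | inr b => (Y.biact x a y b w).compr₂ (p a b ∘ₗ t a b)
            map_add' := fun w w' => LinearMap.ext fun f => funext fun B => by
              cases B with
              | inl b => exact (add_zero _).symm
              | inr b =>
                exact LinearMap.ext fun e => (congrArg (p a b ∘ₗ t a b)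
                  congr($((Y.biact x a y b).map_add w w') f e)).trans
                  (map_add (p a b ∘ₗ t a b) _ _)
            map_smul' := fun c w => LinearMap.ext fun f => funext fun B => by
              cases B with
              | inl b => exact (smul_zero c).symm
              | inr b =>
                exact LinearMap.ext fun e => (congrArg (p a b ∘ₗ t a b)
                  congr($((Y.biact x a y b).map_smul c w) f e)).trans
                  (map_smul (p a b ∘ₗ t a b) _ _) }
        | inr _ => 0
    have hG {x' : C₁} {y' : C₂} (w : Y.at x' y') (Φ : CoindAt V (inl x') (inr y'))
        (h : ∀ (a : C₁) (f : x' ⟶ a) (b : C₂) (e : b ⟶ y'),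
          p a b (t a b (Y.biact x' a y' b w f e)) = Φ (inl a) f (inr b) e) :
        G x' y' w = Φ := by
      exact coindAt_ext V fun a f b e => h a f b e
    refine ⟨Bimod.homMk (N := Y) (N' := r₁₂ (coind V)) G (fun {x x'} y g w => ?_)
      (fun x {y y'} h w => ?_), Bimod.hom_ext fun x y v => ?_⟩
    · rw [Bimod.res_lact', coind_lact]
      refine hG _ _ fun a f b e => ?_
      change p a b (t a b (Y.lact _ _ _ f (Y.ract _ _ _ e (Y.lact _ _ _ g w)))) =
        p a b (t a b (Y.lact _ _ _ (g ≫ f) (Y.ract _ _ _ e w)))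
      rw [← Y.lact_ract, Y.lact_lact]
    · rw [Bimod.res_ract', coind_ract]
      refine hG _ _ fun a f b e => ?_
      change p a b (t a b (Y.lact _ _ _ f (Y.ract _ _ _ e (Y.ract _ _ _ h w)))) =
        p a b (t a b (Y.lact _ _ _ f (Y.ract _ _ _ (e ≫ h) w)))
      rw [Y.ract_ract]
    · refine hG _ _ fun a f b e => ?_
      refine Eq.trans ?_ (hg x y v a f b e).symm
      change p a b (t a b (Y.lact x a b f (Y.ract x y b e (Bimod.homAt i x y v)))) = _
      rw [← Bimod.homAt_ract, ← Bimod.homAt_lact]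
      exact congrArg (p a b) (LinearMap.congr_fun (ht a b) _)

end Glue

/-! ## Relative cohomology in degree one -/

namespace Glue

variable {k : Type u} [Field k] {C₁ C₂ : Type u} [SmallCategory C₁] [Preadditive C₁] [Linear k C₁]
  [SmallCategory C₂] [Preadditive C₂] [Linear k C₂] {M : Bimod k C₁ C₂}
  {N N' : Bimod k (Glue M) (Glue M)}

/-- The `1`-cochain of `C₁ ⊔_M C₂` that is a given morphism on `M` and vanishes on `C₁`, `C₂`. -/
def cochainOfHom (f : M ⟶ r₁₂ N) : ∀ X₀ X₁ : Glue M, (X₁ ⟶ X₀) →ₗ[k] N.at X₀ X₁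
  | inl x, inr y => Bimod.homAt f x y
  | inl _, inl _ => 0
  | inr _, inl _ => 0
  | inr _, inr _ => 0

lemma cochainOfHom_add (f g : M ⟶ r₁₂ N) (X₀ X₁ : Glue M) :
    cochainOfHom (f + g) X₀ X₁ = cochainOfHom f X₀ X₁ + cochainOfHom g X₀ X₁ := by
  cases X₀ <;> cases X₁
  · exact (add_zero _).symm
  · rfl
  · exact (add_zero _).symm
  · exact (add_zero _).symm

lemma cochainOfHom_smul (c : k) (f : M ⟶ r₁₂ N) (X₀ X₁ : Glue M) :
    cochainOfHom (c • f) X₀ X₁ = c • cochainOfHom f X₀ X₁ := by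
  cases X₀ <;> cases X₁
  · exact (smul_zero c).symm
  · rfl
  · exact (smul_zero c).symm
  · exact (smul_zero c).symm

lemma mem_relCochain_one_iff (φ : ∀ X₀ : Glue M, Multi (N.at X₀) 1 X₀) :
    φ ∈ relCochain N 1 ↔ (∀ x x' : C₁, φ (inl x) (inl x') = 0) ∧
      (∀ y y' : C₂, φ (inr y) (inr y') = 0) := by
  rw [mem_relCochain_iff]
  exact ⟨fun h => ⟨fun x x' => congrFun (congrFun h.1 x) x', fun y y' => congrFun (congrFun h.2 y) y'⟩,
    fun h => ⟨funext fun x => funext fun x' => h.1 x x', funext fun y => funext fun y' => h.2 y y'⟩⟩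

/-- `cochainOfHom` as a linear map to relative cochains. -/
def relCochainOfHom (N : Bimod k (Glue M) (Glue M)) : (M ⟶ r₁₂ N) →ₗ[k] relCochain N 1 where
  toFun f := ⟨cochainOfHom f, (mem_relCochain_one_iff _).2 ⟨fun _ _ => rfl, fun _ _ => rfl⟩⟩
  map_add' _ _ := Subtype.ext (funext fun X₀ => funext fun X₁ => cochainOfHom_add _ _ X₀ X₁)
  map_smul' _ _ := Subtype.ext (funext fun X₀ => funext fun X₁ => cochainOfHom_smul _ _ X₀ X₁)

lemma relCochainOfHom_injective : Function.Injective (relCochainOfHom N) := fun _ _ h =>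
  Bimod.hom_ext fun x y m => congr(($h).1 (inl x) (inr y) m)

/-- The cocycle identity has content only on a pair with one argument in `M`, the other being in
`C₁` on its left or in `C₂` on its right; there it is compatibility with the left or the right
action. -/
lemma hmDiff_cochainOfHom (f : M ⟶ r₁₂ N) :
    hmDiff N 1 (fun X₀ => (show Multi (N.at X₀) 1 X₀ from cochainOfHom f X₀)) = 0 := by
  refine funext fun X₀ => Multi.ext fun X₁ g => Multi.ext fun X₂ h => ?_
  refine (hmDiff_one_apply N _ X₀ X₁ X₂ g h).trans ?_
  change N.lact X₁ X₀ X₂ g (cochainOfHom f X₁ X₂ h) - cochainOfHom f X₀ X₂ (h ≫ g) +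
    N.ract X₀ X₁ X₂ h (cochainOfHom f X₀ X₁ g) = 0
  -- The three ways for `g · f(h) - f(g h) + f(g) · h` to vanish: all terms are zero, the last is
  -- zero (left compatibility), or the first is zero (right compatibility).
  have hz {A : ModuleCat.{u} k} {a b c : A} (ha : a = 0) (hb : b = 0) (hc : c = 0) :
      a - b + c = 0 := by rw [ha, hb, hc, sub_zero, add_zero]
  have hl {A : ModuleCat.{u} k} {a b c : A} (hab : a = b) (hc : c = 0) : a - b + c = 0 := by
    rw [hab, hc, sub_self, add_zero]
  have hr {A : ModuleCat.{u} k} {a b c : A} (ha : a = 0) (hbc : b = c) : a - b + c = 0 := by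
    rw [ha, hbc, zero_sub, neg_add_cancel]
  match X₀, X₁, X₂ with
  | inl x₀, inl x₁, inl x₂ => exact hz (map_zero _) rfl (map_zero _)
  | inl x₀, inl x₁, inr y₂ =>
    have e := (Bimod.homAt_lact f y₂ g h).trans
      congr($(Bimod.res_lact' (incl₁ M) (incl₂ M) N x₁ x₀ y₂ g) (Bimod.homAt f x₁ y₂ h))
    exact hl e.symm (map_zero _)
  | inl x₀, inr y₁, inl x₂ =>
    refine hz (map_zero _) rfl ?_
    rw [Subsingleton.elim h 0, map_zero, LinearMap.zero_apply]
  | inl x₀, inr y₁, inr y₂ =>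
    have e := (Bimod.homAt_ract f x₀ h g).trans
      congr($(Bimod.res_ract' (incl₁ M) (incl₂ M) N x₀ y₁ y₂ h) (Bimod.homAt f x₀ y₁ g))
    exact hr (map_zero _) e
  | inr y₀, inl x₁, inl x₂ => exact hz (map_zero _) rfl (map_zero _)
  | inr y₀, inl x₁, inr y₂ =>
    refine hz ?_ rfl (map_zero _)
    rw [Subsingleton.elim g 0, map_zero, LinearMap.zero_apply]
  | inr y₀, inr y₁, inl x₂ => exact hz (map_zero _) rfl (map_zero _)
  | inr y₀, inr y₁, inr y₂ => exact hz (map_zero _) rfl (map_zero _)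

/-- For a relative cocycle, `φ(g) = 0` for `g` in `C₁` turns `g · φ(m) - φ(g m) + φ(g) · m = 0` into
compatibility with the left action; vanishing on `C₂` gives the right action in the same way. -/
lemma exists_relCochainOfHom_eq (φ : relCochain N 1) (hφ : hmDiff N 1 φ.1 = 0) :
    ∃ f, relCochainOfHom N f = φ := by
  obtain ⟨h₁, h₂⟩ := (mem_relCochain_one_iff φ.1).1 φ.2
  have hd (X₀ X₁ X₂ : Glue M) (g : X₁ ⟶ X₀) (h : X₂ ⟶ X₁) :
      N.lact X₁ X₀ X₂ g (φ.1 X₁ X₂ h) - φ.1 X₀ X₂ (h ≫ g) + N.ract X₀ X₁ X₂ h (φ.1 X₀ X₁ g) = 0 :=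
    (hmDiff_one_apply N φ.1 X₀ X₁ X₂ g h).symm.trans congr($hφ X₀ X₁ g X₂ h)
  have hl {A B : ModuleCat.{u} k} {r : A →ₗ[k] B} {a b : B} {c : A} (hc : r c = r 0)
      (h : a - b + r c = 0) : a = b := by
    rwa [hc, map_zero, add_zero, sub_eq_zero] at h
  have hr {A B : ModuleCat.{u} k} {r : A →ₗ[k] B} {a b : B} {c : A} (hc : r c = r 0)
      (h : r c - a + b = 0) : a = b := by
    rwa [hc, map_zero, zero_sub, neg_add_eq_zero] at h
  refine ⟨Bimod.homMk (N := M) (N' := r₁₂ N) (fun x y => φ.1 (inl x) (inr y))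
    (fun {x x'} y g m => ?_) (fun x {y y'} h m => ?_), Subtype.ext ?_⟩
  · have := hd (inl x') (inl x) (inr y) ((incl₁ M).map g) m
    have e : φ.1 (inl x') (inl x) ((incl₁ M).map g) = 0 := congr($(h₁ x' x) g)
    rw [Bimod.res_lact']
    exact (hl (congrArg _ e) this).symm
  · have := hd (inl x) (inr y) (inr y') m ((incl₂ M).map h)
    have e : φ.1 (inr y) (inr y') ((incl₂ M).map h) = 0 := congr($(h₂ y y') h)
    rw [Bimod.res_ract']
    exact hr (congrArg _ e) this
  · refine funext fun X₀ => funext fun X₁ => ?_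
    cases X₀ <;> cases X₁
    · exact (h₁ _ _).symm
    · rfl
    · exact LinearMap.ext fun f => by
        rw [Subsingleton.elim f 0, map_zero]
        exact (map_zero _).symm
    · exact (h₂ _ _).symm

/-- A `0`-cochain is a family indexed by objects, and every object lies in `C₁` or `C₂`. -/
instance : Subsingleton (relCochain N 0) where
  allEq φ ψ := by
    have h (φ : relCochain N 0) : φ.1 = 0 := by
      obtain ⟨h₁, h₂⟩ := (mem_relCochain_iff N).1 φ.2
      refine funext fun X => ?_
      cases X with
      | inl x => exact congr($h₁ x)
      | inr y => exact congr($h₂ y)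
    exact Subtype.ext ((h φ).trans (h ψ).symm)

lemma relComplex_X_zero_isZero : Limits.IsZero ((relComplex N).X 0) :=
  ModuleCat.isZero_of_subsingleton (ModuleCat.of k (relCochain N 0))

/-- The `1`-cocycle given by a morphism of bimodules. -/
def cyclesOfHom (N : Bimod k (Glue M) (Glue M)) :
    ModuleCat.of k (M ⟶ r₁₂ N) ⟶ (relComplex N).cycles 1 :=
  (relComplex N).liftCycles (ModuleCat.ofHom (relCochainOfHom N)) 2 (by simp) (by
    rw [relComplex_d]
    ext f : 2
    exact Subtype.ext (hmDiff_cochainOfHom f))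

lemma cyclesOfHom_iCycles :
    cyclesOfHom N ≫ (relComplex N).iCycles 1 = ModuleCat.ofHom (relCochainOfHom N) :=
  (relComplex N).liftCycles_i _ _ _ _

lemma cyclesOfHom_bijective : Function.Bijective (cyclesOfHom N).hom := by
  have hi (f) : ((relComplex N).iCycles 1).hom ((cyclesOfHom N).hom f) = relCochainOfHom N f :=
    congr(($(cyclesOfHom_iCycles (N := N))).hom f)
  refine ⟨fun f g h => relCochainOfHom_injective (by rw [← hi, ← hi, h]), fun z => ?_⟩
  obtain ⟨f, hf⟩ := exists_relCochainOfHom_eq (((relComplex N).iCycles 1).hom z) (by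
    have := congr(($((relComplex N).iCycles_d 1 2)).hom z)
    rw [relComplex_d] at this
    exact congrArg Subtype.val this)
  exact ⟨f, (ModuleCat.mono_iff_injective _).1 (inferInstanceAs (Mono ((relComplex N).iCycles 1)))
    ((hi f).trans hf)⟩

/-- The identification of the relative cohomology in degree `1` with `Hom (M, r₁₂ N)`. -/
def homEquivRelCohomology (N : Bimod k (Glue M) (Glue M)) :
    (M ⟶ r₁₂ N) ≃ₗ[k] (relComplex N).homology 1 :=
  LinearEquiv.ofBijective (cyclesOfHom N ≫ (relComplex N).homologyπ 1).hom (by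
    -- There are no coboundaries in degree `1`, because the complex vanishes in degree `0`.
    have := (relComplex N).isIso_homologyπ 0 1 (by simp)
      (relComplex_X_zero_isZero.eq_of_src _ _)
    rw [ModuleCat.hom_comp]
    exact ((ConcreteCategory.bijective_of_isIso ((relComplex N).homologyπ 1)).comp
      cyclesOfHom_bijective))

/-- Naturality in the coefficients, used for the first dimension shift, where the terms of the
coinduced bimodule need not vanish. -/
lemma homologyMap_relMap_homEquivRelCohomology (a : N ⟶ N') (f : M ⟶ r₁₂ N) :
    (HomologicalComplex.homologyMap (relMap a) 1).hom (homEquivRelCohomology N f) =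
      homEquivRelCohomology N' (f ≫ (Bimod.resFunctor (incl₁ M) (incl₂ M)).map a) := by
  have h : (HomologicalComplex.cyclesMap (relMap a) 1).hom ((cyclesOfHom N).hom f) =
      (cyclesOfHom N').hom (f ≫ (Bimod.resFunctor (incl₁ M) (incl₂ M)).map a) := by
    refine (ModuleCat.mono_iff_injective ((relComplex N').iCycles 1)).1 inferInstance ?_
    refine (congr(($(HomologicalComplex.cyclesMap_i (relMap a) 1)).hom
      ((cyclesOfHom N).hom f))).trans ?_
    refine (congr(((relMap a).f 1).hom
      (($(cyclesOfHom_iCycles (N := N))).hom f))).trans ?_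
    refine Eq.trans ?_ congr(($(cyclesOfHom_iCycles (N := N'))).hom
      (f ≫ (Bimod.resFunctor (incl₁ M) (incl₂ M)).map a)).symm
    refine Subtype.ext (funext fun X₀ => funext fun X₁ => ?_)
    cases X₀ <;> cases X₁
    · exact LinearMap.comp_zero _
    · rfl
    · exact LinearMap.comp_zero _
    · exact LinearMap.comp_zero _
  refine (congr(($(HomologicalComplex.homologyπ_naturality (relMap a) 1)).hom
      ((cyclesOfHom N).hom f))).trans ?_
  exact congrArg ((relComplex N').homologyπ 1).hom h

end Glue

/-! ## Dimension shifting -/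

/-- Both targets are cokernels, and cokernels of isomorphic maps are isomorphic. -/
lemma exists_linearEquiv_of_exact {k : Type*} [Field k] {A B C A' B' C' : Type*}
    [AddCommGroup A] [AddCommGroup B] [AddCommGroup C] [AddCommGroup A'] [AddCommGroup B']
    [AddCommGroup C'] [Module k A] [Module k B] [Module k C] [Module k A'] [Module k B']
    [Module k C'] {f : A →ₗ[k] B} {g : B →ₗ[k] C} {f' : A' →ₗ[k] B'} {g' : B' →ₗ[k] C'}
    (hfg : Function.Exact f g) (hg : Function.Surjective g) (hfg' : Function.Exact f' g')
    (hg' : Function.Surjective g') (a : A ≃ₗ[k] A') (b : B ≃ₗ[k] B')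
    (hab : ∀ x, b (f x) = f' (a x)) : Nonempty (C ≃ₗ[k] C') := by
  have h : (LinearMap.ker g).map b.toLinearMap = LinearMap.ker g' := by
    rw [hfg.linearMap_ker_eq, hfg'.linearMap_ker_eq]
    ext y
    constructor
    · rintro ⟨_, ⟨x, rfl⟩, rfl⟩
      exact ⟨a x, (hab x).symm⟩
    · rintro ⟨x, rfl⟩
      exact ⟨f (a.symm x), ⟨_, rfl⟩, (hab _).trans (by rw [a.apply_symm_apply])⟩
  exact ⟨(g.quotKerEquivOfSurjective hg).symm ≪≫ₗ Submodule.Quotient.equiv _ _ b h ≪≫ₗ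
    g'.quotKerEquivOfSurjective hg'⟩

/-! ### Relative cohomology as extensions of `M` -/

namespace Glue

variable {k : Type u} [Field k] {C₁ C₂ : Type u} [SmallCategory C₁] [Preadditive C₁] [Linear k C₁]
  [SmallCategory C₂] [Preadditive C₂] [Linear k C₂] {M : Bimod k C₁ C₂}

/-- The cohomology of the boundary is the product of the cohomologies of `C₁` and `C₂`. -/
def boundaryEquiv (N : Bimod k (Glue M) (Glue M)) (n : ℕ) :
    (hmComplex (r₁ N) ⊞ hmComplex (r₂ N)).homology n ≃ₗ[k]
      hmCohomology (r₁ N) n × hmCohomology (r₂ N) n :=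
  biprodEquivProd (HomologicalComplex.homologyFunctor (ModuleCat.{u} k) (ComplexShape.up ℕ) n)
    (hmComplex (r₁ N)) (hmComplex (r₂ N))

lemma boundaryEquiv_toBoundary (N : Bimod k (Glue M) (Glue M)) (n : ℕ) (z : hmCohomology N n) :
    boundaryEquiv N n ((HomologicalComplex.homologyMap (toBoundary N) n).hom z) = res N n z := by
  refine Prod.ext ?_ ?_
  · change (HomologicalComplex.homologyMap (toBoundary N) n ≫
      HomologicalComplex.homologyMap Limits.biprod.fst n).hom z = _
    rw [← HomologicalComplex.homologyMap_comp, toBoundary, Limits.biprod.lift_fst]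
    rfl
  · change (HomologicalComplex.homologyMap (toBoundary N) n ≫
      HomologicalComplex.homologyMap Limits.biprod.snd n).hom z = _
    rw [← HomologicalComplex.homologyMap_comp, toBoundary, Limits.biprod.lift_snd]
    rfl

/-- In the long exact sequence this group lies between the boundary cohomology in degree `n + 1` and
the cohomology of the glued category in degree `n + 2`, both zero. Degree `1` is excluded because
its left neighbour is in degree `0`. -/
lemma relCohomology_coind_isZero (V : Glue M → Glue M → ModuleCat.{u} k) (n : ℕ) :
    Limits.IsZero ((relComplex (coind V)).homology (n + 2)) := by
  have h₁ := hmCohomology_coind_isZero V (n + 1)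
  have h₂ : Limits.IsZero
      ((hmComplex (r₁ (coind V)) ⊞ hmComplex (r₂ (coind V))).homology (n + 1)) := by
    have := ModuleCat.subsingleton_of_isZero (hmCohomology_r₁_coind_isZero V n)
    have := ModuleCat.subsingleton_of_isZero (hmCohomology_r₂_coind_isZero V n)
    have := (boundaryEquiv (coind V) (n + 1)).toEquiv.subsingleton
    exact ModuleCat.isZero_of_subsingleton _
  exact ((boundarySequence_shortExact (coind V)).homology_exact₁ (n + 1) (n + 2)
    (by simp)).isZero_of_both_zeros (h₂.eq_of_src _ _) (h₁.eq_of_tgt _ _)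

/-- The next term of the sequence is `Ext^{n+1}(M, X₂)`, which vanishes by injectivity. With the
following exactness, this presents `Ext^{n+1}(M, X₁)` as the cokernel of `Extⁿ(M, X₂) → Extⁿ(M,
X₃)`. -/
lemma extClass_postcomp_surjective {S : ShortComplex (Bimod k C₁ C₂)} (hS : S.ShortExact)
    [Injective S.X₂] (n : ℕ) : Function.Surjective
      (Abelian.Ext.postcompOfLinear hS.extClass k M (rfl : n + 1 = n + 1)) := fun x =>
  Abelian.Ext.covariant_sequence_exact₁ M hS x (Abelian.Ext.eq_zero_of_injective _) rfl

lemma exact_extClass_postcomp {S : ShortComplex (Bimod k C₁ C₂)} (hS : S.ShortExact) (n : ℕ) :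
    Function.Exact (Abelian.Ext.postcompOfLinear (Abelian.Ext.mk₀ S.g) k M (add_zero n))
      (Abelian.Ext.postcompOfLinear hS.extClass k M (rfl : n + 1 = n + 1)) := fun x =>
  ⟨fun hx => Abelian.Ext.covariant_sequence_exact₃ M hS x rfl hx, by
    rintro ⟨y, rfl⟩
    change (y.comp (Abelian.Ext.mk₀ S.g) (add_zero n)).comp hS.extClass rfl = 0
    rw [Abelian.Ext.comp_assoc_of_second_deg_zero, hS.comp_extClass, Abelian.Ext.comp_zero]⟩

/-- The relative cohomology of `C₁ ⊔_M C₂` is given by the extensions of `M`. -/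
theorem nonempty_relCohomology_equiv_ext (n : ℕ) : ∀ N : Bimod k (Glue M) (Glue M),
    Nonempty ((relComplex N).homology (n + 1) ≃ₗ[k] Abelian.Ext.{u + 1} M (r₁₂ N) n) := by
  induction n with
  | zero => exact fun N =>
      ⟨(homEquivRelCohomology N).symm ≪≫ₗ (Abelian.Ext.linearEquiv₀ (R := k)).symm⟩
  | succ n ih =>
    intro N
    let S : ShortComplex (Bimod k (Glue M) (Glue M)) :=
      ShortComplex.mk (toCoind N) (Limits.cokernel.π (toCoind N)) (Limits.cokernel.condition _)
    have hS : S.ShortExact :=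
      { exact := ShortComplex.exact_cokernel (toCoind N)
        mono_f := inferInstanceAs (Mono (toCoind N))
        epi_g := inferInstanceAs (Epi (Limits.cokernel.π (toCoind N))) }
    have hR := relSequence_shortExact hS
    have hE := Bimod.shortExact_res (incl₁ M) (incl₂ M) hS
    have : Injective (S.map (Bimod.resFunctor (k := k) (incl₁ M) (incl₂ M))).X₂ :=
      injective_r₁₂_coind _
    have hsurj : Function.Surjective (hR.δ (n + 1) (n + 2) (by simp)).hom :=
      (ModuleCat.epi_iff_surjective _).1
        (hR.epi_δ (n + 1) (n + 2) (by simp) (relCohomology_coind_isZero N.at n))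
    have hex := (ShortComplex.ShortExact.moduleCat_exact_iff_function_exact _).1
      (hR.homology_exact₃ (n + 1) (n + 2) (by simp))
    -- For `n = 0` the middle terms are `Hom`-spaces, and the square must be checked to commute by
    -- naturality. For larger `n` they vanish on both sides, so any isomorphism supplied by the
    -- induction hypothesis for the quotient will do.
    cases n with
    | zero =>
      refine exists_linearEquiv_of_exact hex hsurj (exact_extClass_postcomp hE 0)
        (extClass_postcomp_surjective hE 0)
        ((homEquivRelCohomology S.X₂).symm ≪≫ₗ (Abelian.Ext.linearEquiv₀ (R := k)).symm)
        ((homEquivRelCohomology S.X₃).symm ≪≫ₗ (Abelian.Ext.linearEquiv₀ (R := k)).symm)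
        fun x => ?_
      obtain ⟨f, rfl⟩ := (homEquivRelCohomology S.X₂).surjective x
      have h := homologyMap_relMap_homEquivRelCohomology S.g f
      change Abelian.Ext.linearEquiv₀.symm ((homEquivRelCohomology S.X₃).symm
        ((HomologicalComplex.homologyMap (relMap S.g) 1).hom (homEquivRelCohomology S.X₂ f))) =
        (Abelian.Ext.linearEquiv₀.symm ((homEquivRelCohomology S.X₂).symm
          (homEquivRelCohomology S.X₂ f))).comp (Abelian.Ext.mk₀
            ((Bimod.resFunctor (incl₁ M) (incl₂ M)).map S.g)) (add_zero 0)
      rw [h, LinearEquiv.symm_apply_apply, LinearEquiv.symm_apply_apply]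
      exact (Abelian.Ext.mk₀_comp_mk₀ _ _).symm
    | succ n =>
      obtain ⟨e⟩ := ih S.X₃
      have h₁ : Subsingleton ((relSequence S).X₂.homology (n + 2)) :=
        ModuleCat.subsingleton_of_isZero (relCohomology_coind_isZero N.at n)
      have h₂ : Subsingleton (Abelian.Ext.{u + 1} M
          (S.map (Bimod.resFunctor (k := k) (incl₁ M) (incl₂ M))).X₂ (n + 1)) :=
        Abelian.Ext.subsingleton_of_injective _ _ _
      let a : (relSequence S).X₂.homology (n + 2) ≃ₗ[k] Abelian.Ext.{u + 1} M
          (S.map (Bimod.resFunctor (k := k) (incl₁ M) (incl₂ M))).X₂ (n + 1) :=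
        LinearEquiv.ofSubsingleton _ _
      refine exists_linearEquiv_of_exact hex hsurj (exact_extClass_postcomp hE (n + 1))
        (extClass_postcomp_surjective hE (n + 1)) a e fun x => ?_
      rw [h₁.elim x 0, map_zero, map_zero, map_zero]
      exact e.map_zero

end Glue
end HM
end

/-! ### The long exact sequence -/

theorem mainTheorem4 (k : Type u) [Field k] (C₁ C₂ : Type u)
    [SmallCategory C₁] [Preadditive C₁] [Linear k C₁]
    [SmallCategory C₂] [Preadditive C₂] [Linear k C₂]
    (M : HM.Bimod k C₁ C₂) (N : HM.Bimod k (HM.Glue M) (HM.Glue M)) :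
    ∃ (β : ∀ n : ℕ, HM.hmCohomology (HM.Glue.r₁ N) n × HM.hmCohomology (HM.Glue.r₂ N) n →ₗ[k]
          Abelian.Ext.{u + 1} M (HM.Glue.r₁₂ N) n)
      (δ : ∀ n : ℕ, Abelian.Ext.{u + 1} M (HM.Glue.r₁₂ N) n →ₗ[k] HM.hmCohomology N (n + 1)),
      Function.Injective (HM.Glue.res N 0) ∧
      ∀ n : ℕ, Function.Exact (HM.Glue.res N n) (β n) ∧
        Function.Exact (β n) (δ n) ∧
        Function.Exact (δ n) (HM.Glue.res N (n + 1)) := by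
  have hS := HM.Glue.boundarySequence_shortExact N
  have e (n : ℕ) := (HM.Glue.nonempty_relCohomology_equiv_ext n N).some
  let p (n : ℕ) := HM.Glue.boundaryEquiv N n
  have hp (n : ℕ) (z) : p n ((HomologicalComplex.homologyMap (HM.Glue.toBoundary N) n).hom z) =
      HM.Glue.res N n z := HM.Glue.boundaryEquiv_toBoundary N n z
  have hres (n : ℕ) (z) : HM.Glue.res N n z = 0 ↔
      (HomologicalComplex.homologyMap (HM.Glue.toBoundary N) n).hom z = 0 := by
    rw [← hp]
    exact LinearEquiv.map_eq_zero_iff (p n)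
  have h₁ (n : ℕ) := (ShortComplex.ShortExact.moduleCat_exact_iff_function_exact _).1
    (hS.homology_exact₁ n (n + 1) (by simp))
  have h₂ (n : ℕ) := (ShortComplex.ShortExact.moduleCat_exact_iff_function_exact _).1
    (hS.homology_exact₂ n)
  have h₃ (n : ℕ) := (ShortComplex.ShortExact.moduleCat_exact_iff_function_exact _).1
    (hS.homology_exact₃ n (n + 1) (by simp))
  -- The two maps are the connecting map and the map induced by the inclusion of relative cochains,
  -- transported along `H^{n+1}(K(N)) ≅ Extⁿ` and the splitting of the boundary cohomology.
  refine ⟨fun n => (e n).toLinearMap ∘ₗ (hS.δ n (n + 1) (by simp)).hom ∘ₗ (p n).symm.toLinearMap,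
    fun n => (HomologicalComplex.homologyMap (HM.Glue.relInclusion N) (n + 1)).hom ∘ₗ
      (e n).symm.toLinearMap, ?_, fun n => ⟨fun z => ?_, fun z => ?_, fun z => ?_⟩⟩
  · refine (injective_iff_map_eq_zero _).2 fun z hz => ?_
    obtain ⟨w, rfl⟩ := (h₂ 0 z).1 ((hres 0 z).1 hz)
    -- The sequence starts with `0` because there are no relative cochains in degree `0`.
    have : Subsingleton ((HM.Glue.relComplex N).homology 0) :=
      ModuleCat.subsingleton_of_isZero (ShortComplex.isZero_homology_of_isZero_X₂ _
        HM.Glue.relComplex_X_zero_isZero)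
    exact (congrArg _ (this.elim w 0)).trans (map_zero _)
  · refine (LinearEquiv.map_eq_zero_iff (e n)).trans ((h₃ n _).trans ⟨?_, ?_⟩)
    · rintro ⟨w, hw⟩
      exact ⟨w, (hp n w).symm.trans ((congrArg (p n) hw).trans ((p n).apply_symm_apply z))⟩
    · rintro ⟨w, rfl⟩
      exact ⟨w, ((p n).symm_apply_apply _).symm.trans (congrArg (p n).symm (hp n w))⟩
  · refine (h₁ n _).trans ⟨?_, ?_⟩
    · rintro ⟨w, hw⟩
      refine ⟨p n w, ?_⟩
      refine (congrArg (fun v => e n ((hS.δ n (n + 1) (by simp)).hom v))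
        ((p n).symm_apply_apply w)).trans ?_
      exact (congrArg (e n) hw).trans ((e n).apply_symm_apply z)
    · rintro ⟨w, rfl⟩
      exact ⟨(p n).symm w, ((e n).symm_apply_apply _).symm⟩
  · refine (hres (n + 1) z).trans ((h₂ (n + 1) z).trans ⟨?_, ?_⟩)
    · rintro ⟨w, rfl⟩
      exact ⟨e n w, congrArg _ ((e n).symm_apply_apply w)⟩
    · rintro ⟨w, rfl⟩
      exact ⟨(e n).symm w, rfl⟩
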